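/- **Setting.** Let $d\ge 1$, let $|\cdot|$ be the Euclidean norm on $\mathbb{R}^d$, and let $H<\mathrm{GL}(d,\mathbb{R})$ be a closed subgroup with left Haar measure $dh$. Let $G=\mathbb{R}^d\rtimes H$ with product $(x,h)(y,g)=(x+hy,hg)$ and left Haar measure $|\det h|^{-1}\,dx\,dh$. Put $[\pi(x,h)f](y)=|\det h|^{-1/2}f(h^{-1}(y-x))$. Assume that $H$ is admissible, i.e. the unitary representation $\pi$ of $G$ on $L^2(\mathbb{R}^d)$ is irreducible (its only closed invariant subspaces are $\{0\}$ and $L^2(\mathbb{R}^d)$) and square-integrable (there is $0\neq\psi\in L^2(\mathbb{R}^d)$ with $(x,h)\mapsto\langle\psi,\pi(x,h)\psi\rangle$ in $L^2(G)$). Let $\mathcal{O}=\{h^T\xi_0: h\in H\}$ be the open orbit of the dual action $\xi\mapsto h^T\xi$, and $\mathcal{O}^c=\mathbb{R}^d\setminus\mathcal{O}$. A weight on $G$ or $H$ is a continuous, strictly positive, submultiplicative function. With $\widehat f(\xi)=\int f(x)e^{-2\pi i\langle x,\xi\rangle}dx$, write $$|F|_{r,m}=\sup_{x\in\mathbb{R}^d,\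 |\alpha|\le r}(1+|x|)^m|\partial^\alpha F(x)|\in[0,\infty],$$ $$A(\xi)=\min\left(\frac{\mathrm{dist}(\xi,\mathcal{O}^c)}{1+\sqrt{|\xi|^2-\mathrm{dist}(\xi,\mathcal{O}^c)^2}},\ \frac1{1+|\xi|}\right).$$ For $s\ge0$, $1\le q<\infty$, a weight $w$ on $H$ and $\ell\in\mathbb{N}_0$, the orbit $\mathcal{O}$ is *$(s,q,w)$-temperately embedded with index $\ell$* if for some $\xi_0\in\mathcal{O}$ the function $h\mapsto|\det h|^{1/2-1/q}(1+\|h\|)^{s+d+1}w(h)A(h^T\xi_0)^\ell$ is in $L^q(H)$ and the function $h\mapsto|\det h|^{-1/2-1/q}(1+\|h\|)^{s+d+1}w(h)A(h^{-T}\xi_0)^\ell$ is in $L^1(H)$, where $\|\cdot\|$ is the Euclidean operator norm. A function $f\in L^1(\mathbb{R}^d)$ *has vanishing moments in $\mathcal{O}^c$ of order $r\in\mathbb{N}_0$* if all distributional derivatives $\partial^\alpha\widehat f$ with $|\alpha|\le r$ are continuous functions, and those with $|\alpha|<r$ vanish identically on $\mathcal{O}^c$. For $f,\psi\in L^1(\mathbb{R}^d)$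 let $W_\psi f(x,h)=\langle f,\pi(x,h)\psi\rangle=\int_{\mathbb{R}^d}f(y)\,\overline{[\pi(x,h)\psi](y)}\,dy$ (for every $h$ this converges for almost every $x$), and for measurable $F$ on $G$ let $$\|F\|_{L^{p,q}_v}=\left(\int_H\|F(\cdot,h)\,v(\cdot,h)\|_{L^p(\mathbb{R}^d)}^q\,\frac{dh}{|\det h|}\right)^{1/q}\in[0,\infty].$$ **Theorem.** Let $1\le p\le\infty$, $1\le q<\infty$ and $s\ge0$. Let $v$ be a weight on $G$ and $w$ a weight on $H$ with $v(x,h)\le(1+|x|)^s\,w(h)$ for all $(x,h)\in G$. Assume that $\mathcal{O}$ is $(s,q,w)$-temperately embedded with index $\ell$, and let $t\in\mathbb{N}$ satisfy $t>\ell+s+1+d/p$ (with $d/\infty=0$). Then there is a constant $C>0$ such that for all $f,\psi\in L^1(\mathbb{R}^d)$ that have vanishing moments in $\mathcal{O}^c$ of order $t$, the function $W_\psi f$ is measurable on $G$ (with respect to the completed Haar measure) and $$\|W_\psi f\|_{L^{p,q}_v}\le C\,|\widehat f|_{t,t}\,|\widehat\psi|_{t,t},$$ where the right-hand side is read in $[0,\infty]$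 with $0\cdot\infty=0$. -/

import Mathlib

open MeasureTheory
open scoped ENNReal NNReal FourierTransform ContDiff ComplexConjugate

noncomputable section

namespace DualOrbit

/-- Euclidean space `ℝᵈ`. -/
abbrev E (d : ℕ) : Type := EuclideanSpace ℝ (Fin d)

/-- `GL(d, ℝ)`. -/
abbrev GLd (d : ℕ) : Type := Matrix.GeneralLinearGroup (Fin d) ℝ

variable {d : ℕ}

/-! ### Linear actions, determinant and norm -/

/-- The action `y ↦ h y`. -/
def act (h : GLd d) : E d →L[ℝ] E d :=
  Matrix.toEuclideanCLM (n := Fin d) (𝕜 := ℝ) (h : Matrix (Fin d) (Fin d) ℝ)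

/-- The dual action `ξ ↦ hᵀ ξ`. -/
def dualAct (h : GLd d) : E d →L[ℝ] E d :=
  Matrix.toEuclideanCLM (n := Fin d) (𝕜 := ℝ) (h : Matrix (Fin d) (Fin d) ℝ).transpose

/-- `|det h|`. -/
def absDet (h : GLd d) : ℝ := |(h : Matrix (Fin d) (Fin d) ℝ).det|

/-- The norm of `h` as an operator on Euclidean space. -/
def opNorm (h : GLd d) : ℝ := ‖act h‖

/-! ### The quasi-regular representation of `G = ℝᵈ ⋊ H` -/

/-- `[π(x,h) f](y) = |det h|^{-1/2} f(h⁻¹ (y - x))`, on functions. -/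
def quasiRegFun (x : E d) (h : GLd d) (f : E d → ℂ) : E d → ℂ :=
  fun y => ((absDet h ^ (-(1 / 2) : ℝ) : ℝ) : ℂ) * f (act h⁻¹ (y - x))

theorem det_act_ne_zero (h : GLd d) : LinearMap.det (act h : E d →ₗ[ℝ] E d) ≠ 0 := by
  have h1 : act h * act h⁻¹ = 1 := by
    simp only [act, ← map_mul, ← Units.val_mul, mul_inv_cancel, Units.val_one, map_one]
  have h2 : (act h : E d →ₗ[ℝ] E d) * (act h⁻¹ : E d →ₗ[ℝ] E d) = 1 := by
    ext1 x
    exact congrArg (fun T : E d →L[ℝ] E d => T x) h1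
  intro h0
  have h3 := congrArg LinearMap.det h2
  rw [map_mul, h0, zero_mul, map_one] at h3
  exact zero_ne_one h3

theorem memLp_quasiRegFun (x : E d) (h : GLd d) {f : E d → ℂ} (hf : MemLp f 2 volume) :
    MemLp (quasiRegFun x h f) 2 volume := by
  have hdet := det_act_ne_zero (h⁻¹)
  have h1 : MeasurePreserving (act h⁻¹ : E d → E d) volume
      (ENNReal.ofReal |(LinearMap.det (act h⁻¹ : E d →ₗ[ℝ] E d))⁻¹| • volume) :=
    ⟨(act h⁻¹).continuous.measurable, Measure.map_linearMap_addHaar_eq_smul_addHaar volume hdet⟩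
  have h2 : MeasurePreserving (fun y : E d => y - x) volume volume :=
    measurePreserving_sub_right volume x
  exact ((hf.smul_measure ENNReal.ofReal_ne_top).comp_measurePreserving (h1.comp h2)).const_mul _

/-- The operator `π(x,h)` on `L²(ℝᵈ)`. -/
def quasiReg (x : E d) (h : GLd d) (f : Lp ℂ 2 (volume : Measure (E d))) :
    Lp ℂ 2 (volume : Measure (E d)) :=
  (memLp_quasiRegFun x h (Lp.memLp f)).toLp (quasiRegFun x h f)

/-- Irreducibility: the only closed invariant subspaces of `L²(ℝᵈ)` are the trivial ones. -/
def IsIrreducibleRep (H : Subgroup (GLd d)) : Prop :=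
  ∀ V : Submodule ℂ (Lp ℂ 2 (volume : Measure (E d))),
    IsClosed (V : Set (Lp ℂ 2 (volume : Measure (E d)))) →
    (∀ (x : E d) (h : H), ∀ f ∈ V, quasiReg x (h : GLd d) f ∈ V) → V = ⊥ ∨ V = ⊤

/-- The left Haar measure `|det h|⁻¹ dx dh` of `G`, where `dh` is the left Haar measure `μ`
of `H`. -/
def haarG (H : Subgroup (GLd d)) [MeasurableSpace H] (μ : Measure H) : Measure (E d × H) :=
  ((volume : Measure (E d)).prod μ).withDensity
    (fun g => ENNReal.ofReal (absDet (g.2 : GLd d))⁻¹)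

/-- Square-integrability: some nonzero `ψ ∈ L²(ℝᵈ)` has its matrix coefficient
`(x,h) ↦ ⟨ψ, π(x,h)ψ⟩` in `L²(G)`. -/
def IsSquareIntegrableRep (H : Subgroup (GLd d)) [MeasurableSpace H] (μ : Measure H) : Prop :=
  ∃ ψ : Lp ℂ 2 (volume : Measure (E d)), ψ ≠ 0 ∧
    MemLp (fun g : E d × H => inner ℂ (quasiReg g.1 (g.2 : GLd d) ψ) ψ) 2 (haarG H μ)

/-- An admissible dilation group: a closed subgroup of `GL(d, ℝ)` whose quasi-regular
representation is irreducible and square-integrable. -/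
structure IsAdmissibleGroup (H : Subgroup (GLd d)) [MeasurableSpace H] (μ : Measure H) :
    Prop where
  closed : IsClosed (H : Set (GLd d))
  irreducible : IsIrreducibleRep H
  squareIntegrable : IsSquareIntegrableRep H μ

/-- `O` is an open orbit of the dual action of `H`. -/
def IsOpenDualOrbit (H : Subgroup (GLd d)) (O : Set (E d)) : Prop :=
  IsOpen O ∧ ∃ ξ₀ : E d, O = Set.range (fun h : H => dualAct (h : GLd d) ξ₀)

/-! ### Weights and mixed norms -/

/-- A weight on `H`: continuous, positive and submultiplicative. -/
structure IsWeight (H : Subgroup (GLd d)) (w : H → ℝ) : Prop where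
  continuous : Continuous w
  pos : ∀ h, 0 < w h
  submul : ∀ h g, w (h * g) ≤ w h * w g

/-- A weight on `G = ℝᵈ ⋊ H`, with group law `(x,h)(y,g) = (x + h y, h g)`. -/
structure IsWeightG (H : Subgroup (GLd d)) (v : E d → H → ℝ) : Prop where
  continuous : Continuous (fun g : E d × H => v g.1 g.2)
  pos : ∀ x h, 0 < v x h
  submul : ∀ (x : E d) (h : H) (y : E d) (g : H), v (x + act (h : GLd d) y) (h * g) ≤ v x h * v y g

/-- The norm of `L^{p,q}_v(G)`, `1 ≤ p ≤ ∞`, `1 ≤ q < ∞`: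
`(∫_H ‖F(·,h) v(·,h)‖_{L^p(ℝᵈ)}^q dh / |det h|)^{1/q}`, with values in `[0,∞]`. -/
def mixedNorm (H : Subgroup (GLd d)) [MeasurableSpace H] (μ : Measure H) (p : ℝ≥0∞) (q : ℝ)
    (v : E d → H → ℝ) (F : E d → H → ℂ) : ℝ≥0∞ :=
  (∫⁻ h : H, eLpNorm (fun x => F x h * (v x h : ℂ)) p volume ^ q *
    ENNReal.ofReal (absDet (h : GLd d))⁻¹ ∂μ) ^ (1 / q)

/-- The wavelet transform `W_ψ f(x,h) = ⟨f, π(x,h)ψ⟩ = ∫ f(y) conj([π(x,h)ψ](y)) dy`.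
For `f, ψ ∈ L¹` the integral converges, for every `h`, at almost every `x`. -/
def waveletTransform (H : Subgroup (GLd d)) (ψ f : E d → ℂ) (x : E d) (h : H) : ℂ :=
  ∫ y, f y * conj (quasiRegFun x (h : GLd d) ψ y)

/-! ### The auxiliary function and temperate embedding -/

/-- `A(ξ) = min (dist(ξ,Oᶜ) / (1 + √(|ξ|² - dist(ξ,Oᶜ)²)), 1 / (1 + |ξ|))`. -/
def auxA (O : Set (E d)) (ξ : E d) : ℝ :=
  min (Metric.infDist ξ Oᶜ / (1 + √(‖ξ‖ ^ 2 - Metric.infDist ξ Oᶜ ^ 2))) (1 / (1 + ‖ξ‖))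

/-- `O` is `(s,q,w)`-temperately embedded with index `ℓ`. -/
def IsTemperatelyEmbedded (H : Subgroup (GLd d)) [MeasurableSpace H] (μ : Measure H)
    (O : Set (E d)) (s q : ℝ) (w : H → ℝ) (ℓ : ℕ) : Prop :=
  ∃ ξ₀ ∈ O,
    MemLp (fun h : H => absDet (h : GLd d) ^ (1 / 2 - 1 / q) *
      (1 + opNorm (h : GLd d)) ^ (s + d + 1) * w h *
      auxA O (dualAct (h : GLd d) ξ₀) ^ ℓ) (ENNReal.ofReal q) μ ∧
    MemLp (fun h : H => absDet (h : GLd d) ^ (-(1 / 2) - 1 / q) *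
      (1 + opNorm (h : GLd d)) ^ (s + d + 1) * w h *
      auxA O (dualAct (h : GLd d)⁻¹ ξ₀) ^ ℓ) 1 μ

/-! ### Multi-index derivatives, Schwartz norms, vanishing moments -/

/-- The partial derivative `∂ᵢ F`. -/
def partialDeriv (i : Fin d) (F : E d → ℂ) : E d → ℂ :=
  fun x => lineDeriv ℝ F x (EuclideanSpace.single i 1)

/-- `∂^α F = ∂₁^{α₁} ⋯ ∂_d^{α_d} F` for a multi-index `α`. -/
def multiDeriv (α : Fin d → ℕ) (F : E d → ℂ) : E d → ℂ :=
  (List.finRange d).foldr (fun i g => (partialDeriv i)^[α i] g) F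

/-- The Schwartz norm `|F|_{r,m} = sup_{x, |α| ≤ r} (1+|x|)^m |∂^α F(x)|`, in `[0,∞]`. -/
def schwartzNorm (r m : ℕ) (F : E d → ℂ) : ℝ≥0∞ :=
  ⨆ (x : E d) (α : Fin d → ℕ) (_ : ∑ i, α i ≤ r),
    ENNReal.ofReal ((1 + ‖x‖) ^ m * ‖multiDeriv α F x‖)

/-- The distributional derivative `∂^α F` is the function `g` (for continuous `F`, `g`). -/
def IsDistribDeriv (α : Fin d → ℕ) (F g : E d → ℂ) : Prop :=
  ∀ φ : E d → ℂ, ContDiff ℝ ∞ φ → HasCompactSupport φ →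
    ∫ x, F x * multiDeriv α φ x = (-1) ^ (∑ i, α i) * ∫ x, g x * φ x

/-- `f ∈ L¹(ℝᵈ)` has vanishing moments in `Oᶜ` of order `r`: the distributional derivatives of
`𝓕 f` of order at most `r` are continuous functions, and those of order less than `r` vanish
identically on `Oᶜ`. -/
def HasVanishingMoments (O : Set (E d)) (r : ℕ) (f : E d → ℂ) : Prop :=
  Integrable f ∧ ∀ α : Fin d → ℕ, ∑ i, α i ≤ r →
    ∃ g : E d → ℂ, Continuous g ∧ IsDistribDeriv α (𝓕 f) g ∧
      (∑ i, α i < r → ∀ ξ ∈ Oᶜ, g ξ = 0)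

end DualOrbit

end

open DualOrbit

noncomputable section

namespace DualOrbit

variable {d : ℕ}

/-! ### From distributional to classical derivatives -/

/-! For fixed `h`, `W_ψ f(·,h)` is a convolution whose Fourier transform is `|det h|^{1/2} 𝓕f(ξ)
conj(𝓕ψ(hᵀξ))`. Decay of order `m` in `x` therefore costs `m` derivatives of this product, and the
chain rule costs `(1+‖h‖)^m`.

Vanishing on `Oᶜ` pays for this. Taylor expansion from a nearest point `η ∈ Oᶜ`, which is orthogonal
to `ξ - η` because `Oᶜ` is stable under small dilations, bounds `∂^α 𝓕f(ξ)` by a multiple of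
`|𝓕f|_{t,t} A(ξ)^{t-|α|}` (`FlatOn.norm_multiDeriv_le`). Hence, for almost every `x`, `(1+|x|)^m
|W_ψ f(x,h)|` is at most a constant times `|𝓕f|_{t,t} |𝓕ψ|_{t,t} |det h|^{1/2} (1+‖h‖)^m ∫ A(ξ)^n
A(hᵀξ)^n dξ` whenever `m + n ≤ t` (`norm_waveletTransform_le`).

It remains to control this overlap integral in `h`. Lebesgue measure on `O` is dominated by the
image of `|det k|⁻¹ dk` under `k ↦ k⁻ᵀξ₀` (`exists_lintegral_orbit_le`), and `hᵀk⁻ᵀξ₀ = (k⁻¹h)ᵀξ₀`.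
The overlap thus becomes a convolution on `H`. The submultiplicative weight splits along `h =
k·k⁻¹h`, and the two conditions of temperate embedding say that the factors lie in `L¹` and `L^q`;
Young's inequality concludes (`exists_dominating_overlap`). With `m` the least integer above `s +
d/p`, the weighted decay in `x` is `p`-integrable and one power of `A` remains to spare. -/

theorem intervalIntegral_integral_swap_of_compact {f : ℝ → E d → ℂ}
    (hf : Continuous (Function.uncurry f)) {K : Set (E d)} (hK : IsCompact K) {a b : ℝ}
    (h0 : ∀ r ∈ Set.uIcc a b, ∀ x, x ∉ K → f r x = 0) :
    ∫ r in a..b, ∫ x, f r x = ∫ x, ∫ r in a..b, f r x := by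
  apply intervalIntegral_integral_swap
  have h1 : IntegrableOn (Function.uncurry f) (Set.uIcc a b ×ˢ K) (volume.prod volume) :=
    hf.continuousOn.integrableOn_compact (isCompact_uIcc.prod hK)
  have h2 : IntegrableOn (Function.uncurry f) (Set.uIoc a b ×ˢ (Set.univ : Set (E d)))
      (volume.prod volume) := by
    have h3 : IntegrableOn (Function.uncurry f) (Set.uIoc a b ×ˢ K) (volume.prod volume) :=
      h1.mono_set (Set.prod_mono Set.uIoc_subset_uIcc le_rfl)
    refine h3.of_forall_sdiff_eq_zero (measurableSet_uIoc.prod MeasurableSet.univ) ?_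
    rintro ⟨r, x⟩ ⟨⟨hr, -⟩, hx⟩
    refine h0 r (Set.uIoc_subset_uIcc hr) x fun hxK => hx ⟨hr, hxK⟩
  rw [IntegrableOn, ← Measure.prod_restrict, Measure.restrict_univ] at h2
  exact h2

open scoped Pointwise in
/-- The fundamental theorem of calculus along lines, for a continuous function whose distributional
derivative in direction `v` is continuous. -/
theorem sub_eq_intervalIntegral_of_distrib {F G : E d → ℂ} (hF : Continuous F) (hG : Continuous G)
    (v : E d)
    (h : ∀ φ : E d → ℂ, ContDiff ℝ ∞ φ → HasCompactSupport φ →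
      ∫ x, F x * fderiv ℝ φ x v = -∫ x, G x * φ x) (s : ℝ) (x : E d) :
    F (x + s • v) - F x = ∫ r in (0 : ℝ)..s, G (x + r • v) := by
  have hGc : Continuous fun x : E d => ∫ r in (0 : ℝ)..s, G (x + r • v) := by
    apply intervalIntegral.continuous_parametric_intervalIntegral_of_continuous'
    simp only [Function.uncurry_def]
    fun_prop
  have hFc : Continuous fun x : E d => F (x + s • v) - F x := by fun_prop
  suffices hs : (fun x : E d => F (x + s • v) - F x) =
      fun x => ∫ r in (0 : ℝ)..s, G (x + r • v) from congrFun hs x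
  rw [← hFc.ae_eq_iff_eq (μ := volume) hGc]
  refine ae_eq_of_integral_contDiff_smul_eq hFc.locallyIntegrable hGc.locallyIntegrable ?_
  intro g hg hgc
  set φ : E d → ℂ := fun x => (g x : ℂ) with hφdef
  have hφ : ContDiff ℝ ∞ φ := Complex.ofRealCLM.contDiff.comp hg
  have hφc : HasCompactSupport φ := hgc.comp_left (g := fun r : ℝ => (r : ℂ)) (by simp)
  have hφ1 : Continuous (fun x => fderiv ℝ φ x v) :=
    (hφ.continuous_fderiv (by simp)).clm_apply continuous_const
  have htrans : ∀ r : ℝ, ContDiff ℝ ∞ (fun x => φ (x - r • v)) ∧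
      HasCompactSupport (fun x => φ (x - r • v)) := by
    intro r
    refine ⟨hφ.comp (contDiff_id.sub contDiff_const), ?_⟩
    exact hφc.comp_homeomorph (Homeomorph.subRight (r • v))
  have hline : ∀ (x : E d) (r : ℝ), HasDerivAt (fun r : ℝ => φ (x - r • v))
      (-fderiv ℝ φ (x - r • v) v) r := by
    intro x r
    have h1 : HasFDerivAt φ (fderiv ℝ φ (x - r • v)) (x - r • v) :=
      (hφ.differentiable (by simp) _).hasFDerivAt
    have h2 : HasDerivAt (fun r : ℝ => x - r • v) (-v) r := by
      simpa using ((hasDerivAt_id r).smul_const v).const_sub x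
    have h3 := h1.comp_hasDerivAt r h2
    rw [map_neg] at h3
    exact h3
  have hftc : ∀ x : E d, φ (x - s • v) - φ x =
      ∫ r in (0 : ℝ)..s, -fderiv ℝ φ (x - r • v) v := by
    intro x
    rw [intervalIntegral.integral_eq_sub_of_hasDerivAt (fun r _ => hline x r)]
    · simp
    · apply Continuous.intervalIntegrable
      exact (hφ1.comp (by fun_prop : Continuous fun r : ℝ => x - r • v)).neg
  have hcK : IsCompact (tsupport φ) := hφc
  -- Translation invariance moves the difference onto the test function, where the classical
  -- fundamental theorem applies; the hypothesis is then used for each translate `φ(· - r v)`.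
  have hL : ∫ x, g x • (F (x + s • v) - F x) = ∫ x, F x * (φ (x - s • v) - φ x) := by
    have i1 : Integrable fun x => F x * φ (x - s • v) :=
      (hF.mul (htrans s).1.continuous).integrable_of_hasCompactSupport (htrans s).2.mul_left
    have i2 : Integrable fun x => F x * φ x :=
      (hF.mul hφ.continuous).integrable_of_hasCompactSupport hφc.mul_left
    have i3 : Integrable fun x => F (x + s • v) * φ x :=
      ((hF.comp (by fun_prop)).mul hφ.continuous).integrable_of_hasCompactSupport hφc.mul_left
    have e1 : ∫ x, F x * φ (x - s • v) = ∫ x, F (x + s • v) * φ x := by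
      rw [← integral_add_right_eq_self (fun x => F x * φ (x - s • v)) (s • v)]
      simp
    simp only [mul_sub]
    rw [integral_sub i1 i2, e1, ← integral_sub i3 i2]
    congr 1 with x
    simp only [hφdef, Complex.real_smul]
    ring
  rw [hL]
  simp only [hftc]
  have hK' : IsCompact (tsupport φ + (fun r : ℝ => r • v) '' Set.uIcc 0 s) :=
    hcK.add (isCompact_uIcc.image (by fun_prop))
  have hswap1 : ∫ x, F x * ∫ r in (0 : ℝ)..s, -fderiv ℝ φ (x - r • v) v =
      ∫ r in (0 : ℝ)..s, ∫ x, F x * -fderiv ℝ φ (x - r • v) v := by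
    rw [intervalIntegral_integral_swap_of_compact (K := _) _ hK']
    · simp only [intervalIntegral.integral_const_mul]
    · intro r hr x hx
      have : x - r • v ∉ tsupport φ := by
        intro hmem
        exact hx ⟨x - r • v, hmem, r • v, ⟨r, hr, rfl⟩, by simp⟩
      have h0 : fderiv ℝ φ (x - r • v) = 0 :=
        image_eq_zero_of_notMem_tsupport fun h' => this (tsupport_fderiv_subset ℝ h')
      simp [h0]
    · simp only [Function.uncurry_def]
      exact (hF.comp continuous_snd).mul
        (hφ1.comp (by fun_prop : Continuous fun p : ℝ × E d => p.2 - p.1 • v)).neg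
  rw [hswap1]
  have hstep : ∀ r : ℝ, ∫ x, F x * -fderiv ℝ φ (x - r • v) v = ∫ x, G (x + r • v) * φ x := by
    intro r
    have e := h _ (htrans r).1 (htrans r).2
    have e2 : ∀ x, fderiv ℝ (fun x => φ (x - r • v)) x = fderiv ℝ φ (x - r • v) := by
      intro x
      simpa only [sub_eq_add_neg] using fderiv_comp_add_right (𝕜 := ℝ) (f := φ) (x := x) (-(r • v))
    simp only [e2] at e
    simp only [mul_neg]
    rw [integral_neg, e, neg_neg, ← integral_add_right_eq_self (fun x => G x * φ (x - r • v)) (r • v)]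
    simp
  simp only [hstep]
  rw [intervalIntegral_integral_swap_of_compact (K := _) _ hcK]
  · congr 1 with x
    rw [intervalIntegral.integral_mul_const]
    simp [hφdef, Complex.real_smul, mul_comm]
  · intro r _ x hx
    simp [image_eq_zero_of_notMem_tsupport hx]
  · simp only [Function.uncurry_def]
    exact (hG.comp (by fun_prop : Continuous fun p : ℝ × E d => p.2 + p.1 • v)).mul
      (hφ.continuous.comp continuous_snd)

/-- A function with line derivatives `L x v`, where `L` is continuous, is Fréchet
differentiable. -/
theorem hasFDerivAt_of_continuous_lineDeriv {F : E d → ℂ} {L : E d → E d →L[ℝ] ℂ}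
    (hL : Continuous L) (h : ∀ x v, HasLineDerivAt ℝ F (L x v) x v) (x : E d) :
    HasFDerivAt F (L x) x := by
  rw [hasFDerivAt_iff_isLittleO_nhds_zero, Asymptotics.isLittleO_iff]
  intro ε hε
  obtain ⟨δ, hδ, hball⟩ := Metric.continuousAt_iff.1 hL.continuousAt ε hε
  filter_upwards [Metric.ball_mem_nhds (0 : E d) hδ] with v hv
  have hv' : ‖v‖ < δ := by simpa using hv
  -- The mean value inequality on the segment, applied after subtracting the candidate linear part,
  -- turns continuity of `L` at `x` into the little-o estimate.
  have hderiv : ∀ r ∈ Set.Icc (0 : ℝ) 1, HasDerivWithinAt (fun r : ℝ => F (x + r • v) - r • L x v)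
      (L (x + r • v) v - L x v) (Set.Icc 0 1) r := by
    intro r _
    have h1 : HasDerivAt (fun u : ℝ => F (x + r • v + u • v)) (L (x + r • v) v) 0 := h (x + r • v) v
    have h2 : HasDerivAt (fun u : ℝ => F (x + u • v)) (L (x + r • v) v) r := by
      have h3 := HasDerivAt.comp_sub_const (x := r) (a := r) (f := fun u : ℝ => F (x + r • v + u • v))
        (by simpa using h1)
      refine h3.congr_of_eventuallyEq (Filter.Eventually.of_forall fun u => ?_)
      simp only [sub_smul]
      congr 1
      abel
    have h4 : HasDerivAt (fun r : ℝ => r • L x v) (L x v) r := by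
      simpa using (hasDerivAt_id r).smul_const (L x v)
    exact (h2.sub h4).hasDerivWithinAt
  have hb : ∀ r ∈ Set.Ico (0 : ℝ) 1, ‖L (x + r • v) v - L x v‖ ≤ ε * ‖v‖ := by
    intro r hr
    rw [← sub_apply]
    refine (ContinuousLinearMap.le_opNorm _ _).trans ?_
    gcongr
    rw [← dist_eq_norm]
    refine (hball ?_).le
    rw [dist_eq_norm, add_sub_cancel_left, norm_smul, Real.norm_of_nonneg hr.1]
    nlinarith [norm_nonneg v, hr.2]
  have := norm_image_sub_le_of_norm_deriv_le_segment' hderiv hb 1 (by simp)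
  simpa [sub_right_comm] using this

theorem partialDeriv_eq_fderiv {F : E d → ℂ} (hF : Differentiable ℝ F) (i : Fin d) :
    partialDeriv i F = fun x => fderiv ℝ F x (EuclideanSpace.single i 1) := by
  funext x
  exact (hF x).lineDeriv_eq_fderiv

/-- The continuous linear form with coordinates `c`. -/
def coordForm (c : Fin d → ℂ) : E d →L[ℝ] ℂ :=
  ∑ i, (EuclideanSpace.proj i : E d →L[ℝ] ℝ).smulRight (c i)

theorem coordForm_apply (c : Fin d → ℂ) (v : E d) : coordForm c v = ∑ i, (v i : ℂ) * c i := by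
  simp [coordForm, Complex.real_smul]

/-- A continuous function whose first order distributional derivatives are continuous is
Fréchet differentiable. -/
theorem hasFDerivAt_of_distrib {F : E d → ℂ} {G : Fin d → E d → ℂ} (hF : Continuous F)
    (hG : ∀ i, Continuous (G i))
    (h : ∀ i, ∀ φ : E d → ℂ, ContDiff ℝ ∞ φ → HasCompactSupport φ →
      ∫ x, F x * partialDeriv i φ x = -∫ x, G i x * φ x) (x : E d) :
    HasFDerivAt F (coordForm fun i => G i x) x := by
  have hLc : Continuous fun x => coordForm fun i => G i x := by
    unfold coordForm
    refine continuous_finsetSum _ fun i _ => ?_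
    exact (ContinuousLinearMap.smulRightL ℝ (E d) ℂ
      (EuclideanSpace.proj i : E d →L[ℝ] ℝ)).continuous.comp (hG i)
  refine hasFDerivAt_of_continuous_lineDeriv (L := fun x => coordForm fun i => G i x) hLc ?_ x
  intro x v
  have hGv : Continuous fun x => coordForm (fun i => G i x) v := hLc.clm_apply continuous_const
  have key := sub_eq_intervalIntegral_of_distrib hF hGv v (by
    intro φ hφ hφc
    have e1 : ∀ x, fderiv ℝ φ x v = ∑ i, (v i : ℂ) * partialDeriv i φ x := by
      intro x
      rw [show v = ∑ i, v i • EuclideanSpace.single i (1 : ℝ) by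
        ext j; simp [Finset.sum_apply, Pi.single_apply]]
      rw [map_sum]
      refine Finset.sum_congr rfl fun i _ => ?_
      rw [partialDeriv_eq_fderiv (hφ.differentiable (by simp)), map_smul, Complex.real_smul]
      simp [Finset.sum_apply, Pi.single_apply]
    have hi : ∀ i, Continuous (partialDeriv i φ) ∧ HasCompactSupport (partialDeriv i φ) := by
      intro i
      rw [partialDeriv_eq_fderiv (hφ.differentiable (by simp))]
      exact ⟨(hφ.continuous_fderiv (by simp)).clm_apply continuous_const,
        hφc.fderiv_apply (𝕜 := ℝ) _⟩
    simp only [e1, coordForm_apply, Finset.mul_sum, Finset.sum_mul]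
    rw [integral_finsetSum, integral_finsetSum, ← Finset.sum_neg_distrib]
    · refine Finset.sum_congr rfl fun i _ => ?_
      simp only [mul_left_comm (F _), mul_assoc]
      rw [integral_const_mul, integral_const_mul, h i φ hφ hφc, mul_neg]
    · intro i _
      exact ((continuous_const.mul (hG i)).mul hφ.continuous).integrable_of_hasCompactSupport
        hφc.mul_left
    · intro i _
      exact (hF.mul (continuous_const.mul (hi i).1)).integrable_of_hasCompactSupport
        ((hi i).2.mul_left.mul_left))
  have h2 : HasDerivAt (fun s : ℝ => ∫ r in (0 : ℝ)..s, coordForm (fun i => G i (x + r • v)) v)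
      (coordForm (fun i => G i (x + (0 : ℝ) • v)) v) 0 :=
    (hGv.comp (by fun_prop : Continuous fun r : ℝ => x + r • v)).integral_hasStrictDerivAt
      0 0 |>.hasDerivAt
  have h3 : (fun s : ℝ => F (x + s • v)) =
      fun s : ℝ => (∫ r in (0 : ℝ)..s, coordForm (fun i => G i (x + r • v)) v) + F x := by
    funext s
    rw [← key s x]
    ring
  unfold HasLineDerivAt
  rw [h3]
  simpa using h2.add_const (F x)

/-! ### Multi-index derivatives -/

theorem contDiff_partialDeriv {φ : E d → ℂ} (hφ : ContDiff ℝ ∞ φ) (i : Fin d) :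
    ContDiff ℝ ∞ (partialDeriv i φ) := by
  rw [partialDeriv_eq_fderiv (hφ.differentiable (by simp))]
  exact (hφ.fderiv_right (m := ∞) (by simp)).clm_apply contDiff_const

theorem hasCompactSupport_partialDeriv {φ : E d → ℂ} (hφ : ContDiff ℝ ∞ φ)
    (hc : HasCompactSupport φ) (i : Fin d) : HasCompactSupport (partialDeriv i φ) := by
  rw [partialDeriv_eq_fderiv (hφ.differentiable (by simp))]
  exact hc.fderiv_apply (𝕜 := ℝ) _

theorem partialDeriv_comm {φ : E d → ℂ} (hφ : ContDiff ℝ ∞ φ) (i j : Fin d) :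
    partialDeriv i (partialDeriv j φ) = partialDeriv j (partialDeriv i φ) := by
  have hd : Differentiable ℝ (fderiv ℝ φ) :=
    (hφ.fderiv_right (m := ∞) (by simp)).differentiable (by simp)
  have key : ∀ (i j : Fin d) (x : E d), partialDeriv i (partialDeriv j φ) x =
      fderiv ℝ (fderiv ℝ φ) x (EuclideanSpace.single i 1) (EuclideanSpace.single j 1) := by
    intro i j x
    rw [partialDeriv_eq_fderiv ((contDiff_partialDeriv hφ j).differentiable (by simp)),
      partialDeriv_eq_fderiv (hφ.differentiable (by simp))]
    have := (hd x).hasFDerivAt.clm_apply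
      (hasFDerivAt_const (EuclideanSpace.single j (1 : ℝ)) x)
    simp only [this.fderiv]
    simp
  funext x
  rw [key, key]
  exact (hφ.contDiffAt.isSymmSndFDerivAt (by simpa using ENat.LEInfty.out)) _ _

theorem contDiff_iterate_partialDeriv {φ : E d → ℂ} (hφ : ContDiff ℝ ∞ φ) (i : Fin d) (n : ℕ) :
    ContDiff ℝ ∞ ((partialDeriv i)^[n] φ) := by
  induction n with
  | zero => simpa
  | succ n ih => rw [Function.iterate_succ_apply']; exact contDiff_partialDeriv ih i

theorem iterate_partialDeriv_comm {φ : E d → ℂ} (hφ : ContDiff ℝ ∞ φ) (i j : Fin d) (n : ℕ) :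
    (partialDeriv j)^[n] (partialDeriv i φ) = partialDeriv i ((partialDeriv j)^[n] φ) := by
  induction n with
  | zero => rfl
  | succ n ih =>
    rw [Function.iterate_succ_apply', ih, Function.iterate_succ_apply',
      partialDeriv_comm (contDiff_iterate_partialDeriv hφ j n)]

/-- The composition of the operators `∂ᵢ^{αᵢ}` over a list of indices. -/
def listDeriv (l : List (Fin d)) (α : Fin d → ℕ) (F : E d → ℂ) : E d → ℂ :=
  l.foldr (fun i g => (partialDeriv i)^[α i] g) F

theorem contDiff_listDeriv {φ : E d → ℂ} (hφ : ContDiff ℝ ∞ φ) (l : List (Fin d))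
    (α : Fin d → ℕ) : ContDiff ℝ ∞ (listDeriv l α φ) := by
  induction l with
  | nil => exact hφ
  | cons j l ih => exact contDiff_iterate_partialDeriv ih j _

theorem listDeriv_partialDeriv {φ : E d → ℂ} (hφ : ContDiff ℝ ∞ φ) (l : List (Fin d))
    (α : Fin d → ℕ) (i : Fin d) :
    listDeriv l α (partialDeriv i φ) = partialDeriv i (listDeriv l α φ) := by
  induction l with
  | nil => rfl
  | cons j l ih =>
    change (partialDeriv j)^[α j] (listDeriv l α (partialDeriv i φ)) =
      partialDeriv i ((partialDeriv j)^[α j] (listDeriv l α φ))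
    rw [ih, iterate_partialDeriv_comm (contDiff_listDeriv hφ l α)]

theorem listDeriv_congr (F : E d → ℂ) {l : List (Fin d)} {α β : Fin d → ℕ}
    (h : ∀ i ∈ l, α i = β i) : listDeriv l α F = listDeriv l β F := by
  induction l with
  | nil => rfl
  | cons j l ih =>
    change (partialDeriv j)^[α j] (listDeriv l α F) = (partialDeriv j)^[β j] (listDeriv l β F)
    rw [ih fun i hi => h i (List.mem_cons_of_mem _ hi), h j List.mem_cons_self]

theorem listDeriv_add_single {φ : E d → ℂ} (hφ : ContDiff ℝ ∞ φ) {l : List (Fin d)}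
    (hl : l.Nodup) (α : Fin d → ℕ) {i : Fin d} (hi : i ∈ l) :
    listDeriv l (α + Pi.single i 1) φ = partialDeriv i (listDeriv l α φ) := by
  induction l with
  | nil => simp at hi
  | cons j l ih =>
    rw [List.nodup_cons] at hl
    change (partialDeriv j)^[(α + Pi.single i 1 : Fin d → ℕ) j] (listDeriv l (α + Pi.single i 1) φ) =
      partialDeriv i ((partialDeriv j)^[α j] (listDeriv l α φ))
    by_cases hij : i = j
    · subst hij
      have : listDeriv l (α + Pi.single i 1) φ = listDeriv l α φ := by
        refine listDeriv_congr φ fun k hk => ?_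
        have : k ≠ i := fun h => hl.1 (h ▸ hk)
        simp [this]
      rw [this]
      simp [Function.iterate_succ_apply']
    · have hi' : i ∈ l := (List.mem_cons.1 hi).resolve_left hij
      rw [ih hl.2 hi', ← iterate_partialDeriv_comm (contDiff_listDeriv hφ l α)]
      simp [Ne.symm hij]

/-- `multiDeriv` fixes an order of differentiation, so an extra `∂ᵢ` has to be moved to its slot by
symmetry of second derivatives. Only smooth test functions need this. -/
theorem multiDeriv_partialDeriv {φ : E d → ℂ} (hφ : ContDiff ℝ ∞ φ) (α : Fin d → ℕ) (i : Fin d) :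
    multiDeriv α (partialDeriv i φ) = multiDeriv (α + Pi.single i 1) φ := by
  change listDeriv _ α (partialDeriv i φ) = listDeriv _ _ φ
  rw [listDeriv_partialDeriv hφ, listDeriv_add_single hφ (List.nodup_finRange d) α
    (List.mem_finRange i)]

theorem multiDeriv_zero (F : E d → ℂ) : multiDeriv 0 F = F := by
  change listDeriv _ _ F = F
  induction List.finRange d with
  | nil => rfl
  | cons j l ih => exact ih

theorem sum_add_single (α : Fin d → ℕ) (i : Fin d) (n : ℕ) :
    ∑ j, (α + Pi.single i n : Fin d → ℕ) j = ∑ j, α j + n := by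
  simp [Finset.sum_add_distrib]

/-- A family `g` indexed by multi-indices of order at most `t` such that `∂ᵢ g_α = g_{α + eᵢ}`
consists of the multi-index derivatives of `g₀`. -/
theorem multiDeriv_eq_of_family {g : (Fin d → ℕ) → E d → ℂ} {t : ℕ}
    (hg : ∀ α : Fin d → ℕ, ∑ i, α i < t → ∀ i, partialDeriv i (g α) = g (α + Pi.single i 1))
    {α : Fin d → ℕ} (hα : ∑ i, α i ≤ t) : multiDeriv α (g 0) = g α := by
  have hiter : ∀ (n : ℕ) (β : Fin d → ℕ) (j : Fin d), ∑ i, β i + n ≤ t →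
      (partialDeriv j)^[n] (g β) = g (β + Pi.single j n) := by
    intro n β j
    induction n with
    | zero => intro _; simp
    | succ n ih =>
      intro h
      rw [Function.iterate_succ_apply', ih (by omega), hg _ (by rw [sum_add_single]; omega),
        add_assoc, ← Pi.single_add]
  -- Induction over lists without repetition: the multi-index reached is `α` cut down to the indices
  -- already processed, so its order never exceeds `t`.
  have hlist : ∀ l : List (Fin d), l.Nodup →
      listDeriv l α (g 0) = g (fun i => if i ∈ l then α i else 0) := by
    intro l
    induction l with
    | nil => intro _; rfl
    | cons j l ih =>
      intro hl
      rw [List.nodup_cons] at hl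
      change (partialDeriv j)^[α j] (listDeriv l α (g 0)) = _
      have hsum : (fun i => if i ∈ l then α i else 0) + Pi.single j (α j) =
          fun i => if i ∈ j :: l then α i else 0 := by
        funext i
        by_cases hij : i = j
        · subst hij; simp [hl.1]
        · simp [hij]
      rw [ih hl.2, hiter, hsum]
      rw [← sum_add_single, hsum]
      refine (Finset.sum_le_sum fun i _ => ?_).trans hα
      split_ifs <;> simp
  simpa using! hlist _ (List.nodup_finRange d)

/-- Testing the order-`α` identity on `∂ᵢφ` and the order-`α + eᵢ` identity on `φ` gives the same
left-hand side; the signs differ by one factor `-1`. -/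
theorem isDistribDeriv_partial {F g g' : E d → ℂ} {α : Fin d → ℕ} {i : Fin d}
    (h : IsDistribDeriv α F g) (h' : IsDistribDeriv (α + Pi.single i 1) F g')
    (φ : E d → ℂ) (hφ : ContDiff ℝ ∞ φ) (hc : HasCompactSupport φ) :
    ∫ x, g x * partialDeriv i φ x = -∫ x, g' x * φ x := by
  have h1 := h _ (contDiff_partialDeriv hφ i) (hasCompactSupport_partialDeriv hφ hc i)
  have h2 := h' φ hφ hc
  rw [multiDeriv_partialDeriv hφ, h2, sum_add_single, pow_succ] at h1
  have h3 : ((-1 : ℂ) ^ ∑ i, α i) ≠ 0 := pow_ne_zero _ (by norm_num)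
  apply mul_left_cancel₀ h3
  rw [← h1]
  ring

theorem eq_of_isDistribDeriv_zero {F g : E d → ℂ} (hF : Continuous F) (hg : Continuous g)
    (h : IsDistribDeriv 0 F g) : g = F := by
  rw [← hg.ae_eq_iff_eq (μ := volume) hF]
  refine ae_eq_of_integral_contDiff_smul_eq hg.locallyIntegrable hF.locallyIntegrable ?_
  intro φ hφ hc
  have := h (fun x => (φ x : ℂ)) (Complex.ofRealCLM.contDiff.comp hφ)
    (hc.comp_left (g := fun r : ℝ => (r : ℂ)) (by simp))
  rw [multiDeriv_zero] at this
  simp only [Complex.real_smul, mul_comm (φ _ : ℂ)]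
  simpa using this.symm

/-- `F` has classical derivatives of order at most `t`, and those of order less than `t` vanish
on `Z`. -/
structure FlatOn (Z : Set (E d)) (t : ℕ) (F : E d → ℂ) : Prop where
  continuous : ∀ α : Fin d → ℕ, ∑ i, α i ≤ t → Continuous (multiDeriv α F)
  hasFDerivAt : ∀ α : Fin d → ℕ, ∑ i, α i < t → ∀ x, HasFDerivAt (multiDeriv α F)
    (coordForm fun i => multiDeriv (α + Pi.single i 1) F x) x
  eq_zero : ∀ α : Fin d → ℕ, ∑ i, α i < t → ∀ x ∈ Z, multiDeriv α F x = 0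

theorem continuous_fourier {f : E d → ℂ} (hf : Integrable f) : Continuous (𝓕 f) := by
  exact VectorFourier.fourierIntegral_continuous Real.continuous_fourierChar
    (by exact continuous_inner) hf

/-- This joins the distributional hypothesis to the Schwartz norms, which are built from classical
derivatives: the continuous distributional derivatives form a family with `∂ᵢ g_α = g_{α+eᵢ}` and
`g₀ = 𝓕 f`. -/
theorem HasVanishingMoments.flatOn {O : Set (E d)} {t : ℕ} {f : E d → ℂ}
    (h : HasVanishingMoments O t f) : FlatOn Oᶜ t (𝓕 f) := by
  have hF : Continuous (𝓕 f) := continuous_fourier h.1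
  obtain ⟨-, h⟩ := h
  choose! g hgc hg hg0 using h
  have h0 : g 0 = 𝓕 f := eq_of_isDistribDeriv_zero hF (hgc 0 (by simp)) (hg 0 (by simp))
  have hd : ∀ α : Fin d → ℕ, ∑ i, α i < t → ∀ x, HasFDerivAt (g α)
      (coordForm fun i => g (α + Pi.single i 1) x) x := by
    intro α hα
    have hα' : ∀ i, ∑ j, (α + Pi.single i 1 : Fin d → ℕ) j ≤ t := fun i => by
      rw [sum_add_single]; omega
    exact hasFDerivAt_of_distrib (hgc α hα.le) (fun i => hgc _ (hα' i))
      fun i => isDistribDeriv_partial (hg α hα.le) (hg _ (hα' i))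
  have hp : ∀ α : Fin d → ℕ, ∑ i, α i < t → ∀ i, partialDeriv i (g α) = g (α + Pi.single i 1) := by
    intro α hα i
    funext x
    have := ((hd α hα x).hasLineDerivAt (EuclideanSpace.single i 1)).lineDeriv
    rw [partialDeriv, this, coordForm_apply]
    rw [Finset.sum_eq_single i] <;> simp +contextual
  have heq : ∀ α : Fin d → ℕ, ∑ i, α i ≤ t → multiDeriv α (𝓕 f) = g α := by
    intro α hα
    rw [← h0]
    exact multiDeriv_eq_of_family hp hα
  refine ⟨fun α hα => heq α hα ▸ hgc α hα, fun α hα x => ?_, fun α hα => ?_⟩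
  · rw [heq α hα.le]
    convert hd α hα x using 3 with i
    rw [heq _ (by rw [sum_add_single]; omega)]
  · rw [heq α hα.le]
    exact hg0 α hα.le hα

/-! ### Bounds for flat functions -/

theorem FlatOn.contDiff {Z : Set (E d)} {t : ℕ} {F : E d → ℂ} (hF : FlatOn Z t F) (n : ℕ) :
    ∀ α : Fin d → ℕ, ∑ i, α i + n ≤ t → ContDiff ℝ n (multiDeriv α F) := by
  induction n with
  | zero => intro α hα; exact contDiff_zero.2 (hF.continuous α hα)
  | succ n ih =>
    intro α hα
    rw [Nat.cast_add_one, contDiff_succ_iff_hasFDerivAt]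
    refine ⟨_, ?_, hF.hasFDerivAt α (by omega)⟩
    unfold coordForm
    refine ContDiff.sum fun i _ => ?_
    exact (ContinuousLinearMap.smulRightL ℝ (E d) ℂ
      (EuclideanSpace.proj i : E d →L[ℝ] ℝ)).contDiff.comp
        (ih _ (by rw [sum_add_single]; omega))

theorem norm_smulRight_proj_le (i : Fin d) :
    ‖ContinuousLinearMap.smulRightL ℝ (E d) ℂ (EuclideanSpace.proj i : E d →L[ℝ] ℝ)‖ ≤ 1 := by
  refine ContinuousLinearMap.opNorm_le_bound _ zero_le_one fun c => ?_
  refine ContinuousLinearMap.opNorm_le_bound _ (by positivity) fun v => ?_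
  simp only [ContinuousLinearMap.smulRightL_apply_apply, ContinuousLinearMap.smulRight_apply,
    norm_smul, one_mul, mul_comm ‖c‖]
  gcongr
  exact PiLp.norm_apply_le v i

/-- Each Fréchet derivative is a sum of `d` partial derivatives composed with linear maps of norm at
most one, so each order costs a factor `d`. -/
theorem FlatOn.norm_iteratedFDeriv_le {Z : Set (E d)} {t : ℕ} {F : E d → ℂ} (hF : FlatOn Z t F)
    (x : E d) {B : ℝ} (n : ℕ) : ∀ α : Fin d → ℕ, ∑ i, α i + n ≤ t →
    (∀ β : Fin d → ℕ, ∑ i, β i = ∑ i, α i + n → ‖multiDeriv β F x‖ ≤ B) →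
    ‖iteratedFDeriv ℝ n (multiDeriv α F) x‖ ≤ d ^ n * B := by
  induction n with
  | zero => intro α _ h; simpa using h α rfl
  | succ n ih =>
    intro α hα h
    rw [← norm_iteratedFDeriv_fderiv]
    have e : fderiv ℝ (multiDeriv α F) = fun x => ∑ i,
        (ContinuousLinearMap.smulRightL ℝ (E d) ℂ (EuclideanSpace.proj i : E d →L[ℝ] ℝ) ∘
          multiDeriv (α + Pi.single i 1) F) x := by
      funext y
      rw [(hF.hasFDerivAt α (by omega) y).fderiv]
      rfl
    have hc : ∀ i, ContDiff ℝ n (multiDeriv (α + Pi.single i 1) F) := fun i =>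
      hF.contDiff n _ (by rw [sum_add_single]; omega)
    rw [e, iteratedFDeriv_fun_sum_apply fun i _ =>
      ((ContinuousLinearMap.contDiff _).comp (hc i)).contDiffAt]
    refine (norm_sum_le _ _).trans ?_
    have hi : ∀ i ∈ Finset.univ, ‖iteratedFDeriv ℝ n
        (ContinuousLinearMap.smulRightL ℝ (E d) ℂ (EuclideanSpace.proj i : E d →L[ℝ] ℝ) ∘
          multiDeriv (α + Pi.single i 1) F) x‖ ≤ d ^ n * B := by
      intro i _
      refine (ContinuousLinearMap.norm_iteratedFDeriv_comp_left _ (hc i).contDiffAt le_rfl).trans ?_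
      refine (mul_le_of_le_one_left (norm_nonneg _) (norm_smulRight_proj_le i)).trans ?_
      refine ih _ (by rw [sum_add_single]; omega) fun β hβ => h β ?_
      rw [hβ, sum_add_single]
      omega
    refine (Finset.sum_le_sum hi).trans ?_
    simp [pow_succ]
    nlinarith

theorem norm_coordForm_le {c : Fin d → ℂ} {B : ℝ} (hc : ∀ i, ‖c i‖ ≤ B) (v : E d) :
    ‖coordForm c v‖ ≤ d * ‖v‖ * B := by
  rw [coordForm_apply]
  refine (norm_sum_le _ _).trans ((Finset.sum_le_sum fun i _ => ?_).trans (b := ∑ _i : Fin d, ‖v‖ * B) ?_)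
  · rw [norm_mul, Complex.norm_real]
    exact mul_le_mul (PiLp.norm_apply_le v i) (hc i) (norm_nonneg _) (norm_nonneg _)
  · simp [mul_assoc]

/-- A bound along a segment that starts in `Z`, from a bound for the derivatives of top order. -/
theorem FlatOn.norm_le_segment {Z : Set (E d)} {t : ℕ} {F : E d → ℂ} (hF : FlatOn Z t F)
    {η v : E d} (hη : η ∈ Z) {M : ℝ}
    (hM : ∀ α : Fin d → ℕ, ∑ i, α i = t → ∀ r ∈ Set.Icc (0 : ℝ) 1,
      ‖multiDeriv α F (η + r • v)‖ ≤ M) (n : ℕ) :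
    ∀ α : Fin d → ℕ, ∑ i, α i + n = t → ∀ r ∈ Set.Icc (0 : ℝ) 1,
      ‖multiDeriv α F (η + r • v)‖ ≤ (d * ‖v‖) ^ n * M := by
  induction n with
  | zero => simpa using hM
  | succ n ih =>
    intro α hα r hr
    -- `M` is only known to be nonnegative through a multi-index that it bounds; such an `α + eᵢ`
    -- exists when `d > 0`, and otherwise the product is zero.
    have hM0 : 0 ≤ (d * ‖v‖) * ((d * ‖v‖) ^ n * M) := by
      rcases Nat.eq_zero_or_pos d with rfl | hd
      · simp
      · have : 0 ≤ (d * ‖v‖) ^ n * M := (norm_nonneg _).trans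
          (ih (α + Pi.single ⟨0, hd⟩ 1) (by rw [sum_add_single]; omega) r hr)
        positivity
    have hderiv : ∀ r ∈ Set.Icc (0 : ℝ) 1, HasDerivWithinAt
        (fun r : ℝ => multiDeriv α F (η + r • v))
        (coordForm (fun i => multiDeriv (α + Pi.single i 1) F (η + r • v)) v) (Set.Icc 0 1) r := by
      intro r _
      have h2 : HasDerivAt (fun r : ℝ => η + r • v) v r := by
        simpa using ((hasDerivAt_id r).smul_const v).const_add η
      exact ((hF.hasFDerivAt α (by omega) _).comp_hasDerivAt r h2).hasDerivWithinAt
    have hb : ∀ r ∈ Set.Ico (0 : ℝ) 1,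
        ‖coordForm (fun i => multiDeriv (α + Pi.single i 1) F (η + r • v)) v‖ ≤
          (d * ‖v‖) * ((d * ‖v‖) ^ n * M) := by
      intro r hr
      exact norm_coordForm_le (fun i => ih _ (by rw [sum_add_single]; omega) r ⟨hr.1, hr.2.le⟩) v
    have h0 : multiDeriv α F (η + (0 : ℝ) • v) = 0 := by
      simpa using hF.eq_zero α (by omega) η hη
    have := norm_image_sub_le_of_norm_deriv_le_segment' hderiv hb r hr
    rw [h0, sub_zero, sub_zero] at this
    refine this.trans ((mul_le_of_le_one_right hM0 hr.2).trans (le_of_eq ?_))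
    ring

/-! ### Geometry of the complement of an open orbit -/

theorem dualAct_mul (h g : GLd d) (ξ : E d) : dualAct (h * g) ξ = dualAct g (dualAct h ξ) := by
  have : dualAct (h * g) = dualAct g * dualAct h := by
    simp only [dualAct, Units.val_mul, Matrix.transpose_mul, map_mul]
  rw [this]
  rfl

theorem dualAct_one (ξ : E d) : dualAct (1 : GLd d) ξ = ξ := by
  simp [dualAct]

theorem dualAct_mem_orbit {H : Subgroup (GLd d)} {O : Set (E d)} (hO : IsOpenDualOrbit H O)
    (h : H) {ξ : E d} (hξ : ξ ∈ O) : dualAct (h : GLd d) ξ ∈ O := by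
  obtain ⟨-, ξ₀, rfl⟩ := hO
  obtain ⟨g, rfl⟩ := hξ
  exact ⟨g * h, by simp [dualAct_mul]⟩

theorem exists_dualAct_eq {H : Subgroup (GLd d)} {O : Set (E d)} (hO : IsOpenDualOrbit H O)
    {ξ ξ' : E d} (hξ : ξ ∈ O) (hξ' : ξ' ∈ O) : ∃ h : H, dualAct (h : GLd d) ξ = ξ' := by
  obtain ⟨-, ξ₀, rfl⟩ := hO
  obtain ⟨g, rfl⟩ := hξ
  obtain ⟨g', rfl⟩ := hξ'
  refine ⟨g⁻¹ * g', ?_⟩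
  simp only [← dualAct_mul, Subgroup.coe_mul, Subgroup.coe_inv, mul_inv_cancel_left]

/-- The orbit of `0` is `{0}`, which is not open for `d ≥ 1`. Thus `Oᶜ` is nonempty and nearest
points exist. -/
theorem zero_notMem_orbit (hd : 1 ≤ d) {H : Subgroup (GLd d)} {O : Set (E d)}
    (hO : IsOpenDualOrbit H O) : (0 : E d) ∉ O := by
  intro h0
  have : Nonempty (Fin d) := ⟨⟨0, hd⟩⟩
  have hsub : O ⊆ {0} := by
    intro ξ hξ
    obtain ⟨h, rfl⟩ := exists_dualAct_eq hO h0 hξ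
    simp
  have h1 : (0 : E d) ∈ interior {(0 : E d)} :=
    interior_mono hsub (by rwa [hO.1.interior_eq])
  simp at h1

/-- The complement of an open orbit is invariant under dilations close to the identity. -/
theorem eventually_smul_notMem_orbit {H : Subgroup (GLd d)} {O : Set (E d)}
    (hO : IsOpenDualOrbit H O) :
    ∀ᶠ u : ℝ in nhds 0, ∀ η ∉ O, η + u • η ∉ O := by
  obtain ⟨ξ₀, hξ₀⟩ : ∃ ξ₀, ξ₀ ∈ O := by
    obtain ⟨-, ξ₀, rfl⟩ := hO
    exact ⟨ξ₀, 1, by simp [dualAct_one]⟩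
  -- Dilations commute with the dual action, so `(1+u)η ∈ O` puts `η` in the orbit of `(1+u)⁻¹ξ₀`,
  -- which is `O` for small `u`. The smallness depends on `ξ₀` only, hence is uniform in `η`.
  have hc : ContinuousAt (fun u : ℝ => (1 + u)⁻¹ • ξ₀) 0 := by
    have h : ContinuousAt (fun u : ℝ => (1 + u)⁻¹) 0 :=
      ContinuousAt.inv₀ (by fun_prop) (by simp)
    exact h.smul continuousAt_const
  have h1 : ∀ᶠ u : ℝ in nhds 0, (1 + u)⁻¹ • ξ₀ ∈ O :=
    hc.eventually_mem (hO.1.mem_nhds (by simpa using hξ₀))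
  have h2 : ∀ᶠ u : ℝ in nhds 0, -1 < u := lt_mem_nhds (by norm_num)
  filter_upwards [h1, h2] with u hu hu1 η hη hmem
  obtain ⟨h, hh⟩ := exists_dualAct_eq hO hξ₀ hmem
  apply hη
  have hne : (1 + u) ≠ 0 := by linarith
  have hsm : η + u • η = (1 + u) • η := by rw [add_smul, one_smul]
  have hη' : dualAct (h : GLd d) ((1 + u)⁻¹ • ξ₀) = η := by
    rw [map_smul, hh, hsm, smul_smul, inv_mul_cancel₀ hne, one_smul]
  rw [← hη']
  exact dualAct_mem_orbit hO h hu

/-- A nearest point of the complement of an open orbit is orthogonal to the difference vector. -/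
theorem exists_nearest_orthogonal (hd : 1 ≤ d) {H : Subgroup (GLd d)} {O : Set (E d)}
    (hO : IsOpenDualOrbit H O) (ξ : E d) :
    ∃ η ∈ Oᶜ, ‖ξ - η‖ = Metric.infDist ξ Oᶜ ∧ inner ℝ η (ξ - η) = 0 := by
  obtain ⟨η, hη, hdist⟩ := hO.1.isClosed_compl.exists_infDist_eq_dist
    ⟨0, zero_notMem_orbit hd hO⟩ ξ
  refine ⟨η, hη, by rw [hdist, dist_eq_norm], ?_⟩
  -- Small dilates of `η` stay in `Oᶜ`, so orthogonality is the first-order condition for the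
  -- distance along the ray.
  have hmin : IsLocalMin (fun u : ℝ => ‖ξ - (η + u • η)‖ ^ 2) 0 := by
    filter_upwards [eventually_smul_notMem_orbit hO] with u hu
    have h1 : Metric.infDist ξ Oᶜ ≤ dist ξ (η + u • η) := Metric.infDist_le_dist_of_mem (hu η hη)
    rw [hdist, dist_eq_norm, dist_eq_norm] at h1
    simp only [zero_smul, add_zero]
    gcongr
  have hderiv : HasDerivAt (fun u : ℝ => ‖ξ - (η + u • η)‖ ^ 2)
      (-(2 * inner ℝ η (ξ - η))) 0 := by
    have h2 : HasDerivAt (fun u : ℝ => ξ - (η + u • η)) (-η) 0 := by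
      simpa using (((hasDerivAt_id (0 : ℝ)).smul_const η).const_add η).const_sub ξ
    have := h2.norm_sq
    simpa [inner_neg_right, real_inner_comm] using this
  have := hmin.hasDerivAt_eq_zero hderiv
  linarith

theorem auxA_nonneg (O : Set (E d)) (ξ : E d) : 0 ≤ auxA O ξ := by
  have := Metric.infDist_nonneg (x := ξ) (s := Oᶜ)
  unfold auxA
  positivity

theorem auxA_le_one (O : Set (E d)) (ξ : E d) : auxA O ξ ≤ 1 := by
  refine (min_le_right _ _).trans ?_
  rw [div_le_one (by positivity)]
  linarith [norm_nonneg ξ]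

/-- Decay of a function that is flat on the complement of an open orbit. -/
theorem FlatOn.norm_multiDeriv_le (hd : 1 ≤ d) {H : Subgroup (GLd d)} {O : Set (E d)}
    (hO : IsOpenDualOrbit H O) {t : ℕ} {F : E d → ℂ} (hF : FlatOn Oᶜ t F) {N : ℝ}
    (hN : ∀ (x : E d) (α : Fin d → ℕ), ∑ i, α i ≤ t → (1 + ‖x‖) ^ t * ‖multiDeriv α F x‖ ≤ N)
    (ξ : E d) {α : Fin d → ℕ} (hα : ∑ i, α i ≤ t) :
    ‖multiDeriv α F ξ‖ ≤ d ^ t * N * auxA O ξ ^ (t - ∑ i, α i) := by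
  have hN0 : 0 ≤ N := le_trans (by positivity) (hN 0 α hα)
  have hd1 : (1 : ℝ) ≤ d := by exact_mod_cast hd
  have hN' : ∀ (x : E d) (α : Fin d → ℕ), ∑ i, α i ≤ t →
      ‖multiDeriv α F x‖ ≤ N / (1 + ‖x‖) ^ t := by
    intro x α hα
    rw [le_div_iff₀ (by positivity), mul_comm]
    exact hN x α hα
  set n := t - ∑ i, α i with hn
  have hnt : n ≤ t := Nat.sub_le _ _
  obtain ⟨η, hη, hδ, horth⟩ := exists_nearest_orthogonal hd hO ξ
  set v := ξ - η with hv
  have hnorm : ∀ r : ℝ, ‖η + r • v‖ ^ 2 = ‖η‖ ^ 2 + r ^ 2 * ‖v‖ ^ 2 := by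
    intro r
    rw [norm_add_sq_real, inner_smul_right, horth, norm_smul, mul_pow, Real.norm_eq_abs, sq_abs]
    ring
  -- By orthogonality the segment from `η` to `ξ` never comes closer to the origin than `η`, and
  -- `‖η‖` is the square root in `auxA`. The top-order derivatives on it are thus at most `N / (1 +
  -- ‖η‖)^t`.
  have hge : ∀ r : ℝ, ‖η‖ ≤ ‖η + r • v‖ := by
    intro r
    refine le_of_sq_le_sq ?_ (norm_nonneg _)
    rw [hnorm]
    nlinarith [mul_nonneg (sq_nonneg r) (sq_nonneg ‖v‖)]
  have hξ : ξ = η + (1 : ℝ) • v := by simp [hv]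
  have hηnorm : ‖η‖ = √(‖ξ‖ ^ 2 - Metric.infDist ξ Oᶜ ^ 2) := by
    rw [← hδ, hξ, hnorm]
    simp
  have h1 : ‖multiDeriv α F ξ‖ ≤ d ^ t * N *
      (Metric.infDist ξ Oᶜ / (1 + √(‖ξ‖ ^ 2 - Metric.infDist ξ Oᶜ ^ 2))) ^ n := by
    have := hF.norm_le_segment hη (v := v) (M := N / (1 + ‖η‖) ^ t) (by
      intro β hβ r _
      refine (hN' _ β hβ.le).trans ?_
      gcongr
      exact hge r) n α (by omega) 1 (by simp)
    rw [← hξ] at this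
    refine this.trans ?_
    rw [← hηnorm, ← hδ, mul_pow, div_pow]
    have e : (d : ℝ) ^ n * ‖v‖ ^ n * (N / (1 + ‖η‖) ^ t) =
        d ^ n * N * (‖v‖ ^ n / (1 + ‖η‖) ^ t) := by ring
    rw [e]
    gcongr
    linarith [norm_nonneg η]
  have h2 : ‖multiDeriv α F ξ‖ ≤ d ^ t * N * (1 / (1 + ‖ξ‖)) ^ n := by
    refine (hN' ξ α hα).trans ?_
    rw [div_pow, one_pow, div_eq_mul_one_div]
    have : N ≤ d ^ t * N := le_mul_of_one_le_left hN0 (one_le_pow₀ hd1)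
    gcongr
    linarith [norm_nonneg ξ]
  unfold auxA
  rcases min_choice (Metric.infDist ξ Oᶜ / (1 + √(‖ξ‖ ^ 2 - Metric.infDist ξ Oᶜ ^ 2)))
    (1 / (1 + ‖ξ‖)) with h | h <;> rw [h]
  · exact h1
  · exact h2

theorem FlatOn.norm_iteratedFDeriv_le_auxA (hd : 1 ≤ d) {H : Subgroup (GLd d)} {O : Set (E d)}
    (hO : IsOpenDualOrbit H O) {t : ℕ} {F : E d → ℂ} (hF : FlatOn Oᶜ t F) {N : ℝ}
    (hN : ∀ (x : E d) (α : Fin d → ℕ), ∑ i, α i ≤ t → (1 + ‖x‖) ^ t * ‖multiDeriv α F x‖ ≤ N)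
    (ξ : E d) {n ℓ : ℕ} (hn : n + ℓ ≤ t) :
    ‖iteratedFDeriv ℝ n F ξ‖ ≤ d ^ (2 * t) * N * auxA O ξ ^ ℓ := by
  have hN0 : 0 ≤ N := le_trans (by positivity) (hN 0 0 (by simp))
  have hd1 : (1 : ℝ) ≤ d := by exact_mod_cast hd
  have h0 := auxA_nonneg O ξ
  have := hF.norm_iteratedFDeriv_le ξ (B := d ^ t * N * auxA O ξ ^ ℓ) n 0 (by simp; omega) (by
    intro β hβ
    have hβ' : ∑ i, β i = n := by simpa using hβ
    refine (hF.norm_multiDeriv_le hd hO hN ξ (by omega)).trans ?_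
    gcongr ?_ * ?_
    exact pow_le_pow_of_le_one h0 (auxA_le_one O ξ) (by omega))
  rw [multiDeriv_zero] at this
  refine this.trans ?_
  have e : (d : ℝ) ^ n * (d ^ t * N * auxA O ξ ^ ℓ) = d ^ (n + t) * N * auxA O ξ ^ ℓ := by ring
  rw [e]
  gcongr
  omega

/-! ### Linear changes of variables -/

theorem absDet_pos (h : GLd d) : 0 < absDet h := by
  have : (h : Matrix (Fin d) (Fin d) ℝ).det ≠ 0 := by
    have := h.isUnit
    rw [Matrix.isUnit_iff_isUnit_det] at this
    exact this.ne_zero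
  exact abs_pos.2 this

theorem absDet_mul (h g : GLd d) : absDet (h * g) = absDet h * absDet g := by
  simp [absDet, abs_mul]

theorem absDet_one : absDet (1 : GLd d) = 1 := by
  simp [absDet]

theorem absDet_inv (h : GLd d) : absDet h⁻¹ = (absDet h)⁻¹ := by
  have := absDet_mul h h⁻¹
  rw [mul_inv_cancel, absDet_one] at this
  exact eq_inv_of_mul_eq_one_right this.symm

theorem det_toEuclideanCLM (M : Matrix (Fin d) (Fin d) ℝ) :
    LinearMap.det (Matrix.toEuclideanCLM (n := Fin d) (𝕜 := ℝ) M : E d →ₗ[ℝ] E d) = M.det := by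
  rw [Matrix.coe_toEuclideanCLM_eq_toEuclideanLin, Matrix.toEuclideanLin_eq_toLin_orthonormal]
  exact LinearMap.det_toLin _ M

theorem dualAct_eq_star (h : GLd d) : dualAct h = star (act h) := by
  rw [act, ← map_star, Matrix.star_eq_conjTranspose, Matrix.conjTranspose_eq_transpose_of_trivial,
    dualAct]

theorem norm_dualAct (h : GLd d) : ‖dualAct h‖ = opNorm h := by
  rw [dualAct_eq_star, ContinuousLinearMap.star_eq_adjoint, LinearIsometryEquiv.norm_map, opNorm]

theorem inner_act (h : GLd d) (u ξ : E d) : inner ℝ (act h u) ξ = inner ℝ u (dualAct h ξ) := by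
  rw [dualAct_eq_star, ContinuousLinearMap.star_eq_adjoint,
    ContinuousLinearMap.adjoint_inner_right]

theorem act_mul (h g : GLd d) (x : E d) : act (h * g) x = act h (act g x) := by
  have : act (h * g) = act h * act g := by
    simp only [act, Units.val_mul, map_mul]
  rw [this]
  rfl

theorem act_one (x : E d) : act (1 : GLd d) x = x := by
  simp [act]

theorem act_inv_act (h : GLd d) (x : E d) : act h⁻¹ (act h x) = x := by
  rw [← act_mul, inv_mul_cancel, act_one]

theorem dualAct_inv_dualAct (h : GLd d) (ξ : E d) : dualAct h⁻¹ (dualAct h ξ) = ξ := by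
  rw [← dualAct_mul, mul_inv_cancel, dualAct_one]

theorem map_act_volume (h : GLd d) :
    (volume : Measure (E d)).map (act h) = ENNReal.ofReal (absDet h)⁻¹ • volume := by
  have e : LinearMap.det (act h : E d →ₗ[ℝ] E d) = (h : Matrix (Fin d) (Fin d) ℝ).det :=
    det_toEuclideanCLM _
  have := Measure.map_linearMap_addHaar_eq_smul_addHaar (volume : Measure (E d)) (det_act_ne_zero h)
  rw [e, abs_inv] at this
  exact this

theorem map_dualAct_volume (h : GLd d) :
    (volume : Measure (E d)).map (dualAct h) = ENNReal.ofReal (absDet h)⁻¹ • volume := by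
  have e : LinearMap.det (dualAct h : E d →ₗ[ℝ] E d) = (h : Matrix (Fin d) (Fin d) ℝ).det := by
    rw [dualAct, det_toEuclideanCLM, Matrix.det_transpose]
  have hne : LinearMap.det (dualAct h : E d →ₗ[ℝ] E d) ≠ 0 := by
    rw [e]
    exact abs_pos.1 (absDet_pos h)
  have := Measure.map_linearMap_addHaar_eq_smul_addHaar (volume : Measure (E d)) hne
  rw [e, abs_inv] at this
  exact this

theorem lintegral_comp_dualAct (h : GLd d) {F : E d → ℝ≥0∞} (hF : Measurable F) :
    ∫⁻ ξ, F (dualAct h ξ) = ENNReal.ofReal (absDet h)⁻¹ * ∫⁻ ξ, F ξ := by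
  rw [← lintegral_map hF (dualAct h).continuous.measurable, map_dualAct_volume,
    lintegral_smul_measure, smul_eq_mul]

theorem measurableEmbedding_act (h : GLd d) : MeasurableEmbedding (act h) := by
  have hinj : Function.Injective (act h) :=
    Function.LeftInverse.injective (g := act h⁻¹) (act_inv_act h)
  exact (act h).continuous.measurableEmbedding hinj

theorem integral_comp_act (h : GLd d) (G : E d → ℂ) :
    ∫ z, G z = (absDet h : ℂ) * ∫ u, G (act h u) := by
  have h1 : ∫ u, G (act h u) = ∫ z, G z ∂((volume : Measure (E d)).map (act h)) :=
    ((measurableEmbedding_act h).integral_map _).symm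
  have hp := absDet_pos h
  have hc : (absDet h : ℂ) ≠ 0 := by exact_mod_cast hp.ne'
  rw [h1, map_act_volume, integral_smul_measure, ENNReal.toReal_ofReal (by positivity),
    Complex.real_smul]
  push_cast
  rw [mul_inv_cancel_left₀ hc]

theorem integrable_comp_act (h : GLd d) {G : E d → ℂ} (hG : Integrable G) :
    Integrable fun u => G (act h u) := by
  have h1 : Integrable G ((volume : Measure (E d)).map (act h)) := by
    rw [map_act_volume]
    exact hG.smul_measure ENNReal.ofReal_ne_top
  exact ((measurableEmbedding_act h).integrable_map_iff).1 h1

/-! ### Fourier inversion almost everywhere -/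

theorem integral_fourier_mul {f g : E d → ℂ} (hf : Integrable f) (hg : Integrable g) :
    ∫ ξ, 𝓕 f ξ * g ξ = ∫ x, f x * 𝓕 g x := by
  simpa using! VectorFourier.integral_fourierIntegral_smul_eq_flip (L := innerₗ (E d))
    Real.continuous_fourierChar (by exact continuous_inner) hf hg

/-- Since `f` need not be continuous, inversion holds only almost everywhere. A test function is
written as the transform of a Schwartz function, and the transform is moved across the integral
twice. -/
theorem ae_eq_fourierInv_fourier {f : E d → ℂ} (hf : Integrable f) (hf' : Integrable (𝓕 f)) :
    f =ᵐ[volume] 𝓕⁻ (𝓕 f) := by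
  have hinv : Continuous (𝓕⁻ (𝓕 f)) := by
    have : 𝓕⁻ (𝓕 f) = fun x => 𝓕 (𝓕 f) (-x) := by
      funext x
      exact Real.fourierInv_eq_fourier_neg _ _
    rw [this]
    exact (continuous_fourier hf').comp continuous_neg
  refine ae_eq_of_integral_contDiff_smul_eq hf.locallyIntegrable hinv.locallyIntegrable ?_
  intro g hg hgc
  set φ : SchwartzMap (E d) ℂ := HasCompactSupport.toSchwartzMap
    (f := fun x => (g x : ℂ)) (hgc.comp_left (g := fun r : ℝ => (r : ℂ)) (by simp))
    (Complex.ofRealCLM.contDiff.comp hg) with hφ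
  have hφg : ∀ x, φ x = (g x : ℂ) := fun x => rfl
  set χ : SchwartzMap (E d) ℂ := 𝓕⁻ φ with hχ
  have hχφ : 𝓕 (χ : E d → ℂ) = φ := by
    rw [← SchwartzMap.fourier_coe, hχ, FourierTransform.fourier_fourierInv_eq]
  have hχneg : ∀ x, χ x = 𝓕 (fun y => φ (-y)) x := by
    intro x
    rw [hχ, SchwartzMap.fourierInv_coe, Real.fourierInv_eq_fourier_comp_neg]
  have hφn : Integrable fun y => φ (-y) := φ.integrable.comp_neg
  calc ∫ x, g x • f x = ∫ x, 𝓕 (χ : E d → ℂ) x * f x := by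
        simp only [hχφ, hφg, Complex.real_smul]
    _ = ∫ x, χ x * 𝓕 f x := integral_fourier_mul χ.integrable hf
    _ = ∫ x, 𝓕 (fun y => φ (-y)) x * 𝓕 f x := by simp only [hχneg]
    _ = ∫ x, φ (-x) * 𝓕 (𝓕 f) x := integral_fourier_mul hφn hf'
    _ = ∫ x, φ x * 𝓕 (𝓕 f) (-x) := by
        rw [← integral_neg_eq_self]
        simp
    _ = ∫ x, g x • 𝓕⁻ (𝓕 f) x := by
        simp only [Real.fourierInv_eq_fourier_neg, hφg, Complex.real_smul]

/-! ### The Fourier transform of wavelet coefficients -/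

/-- The function `z ↦ |det h|^{-1/2} conj (ψ (-h⁻¹ z))`. -/
def waveletKernel (ψ : E d → ℂ) (h : GLd d) (z : E d) : ℂ :=
  ((absDet h ^ (-(1 / 2) : ℝ) : ℝ) : ℂ) * conj (ψ (act h⁻¹ (-z)))

open scoped Convolution in
theorem waveletTransform_eq_convolution (H : Subgroup (GLd d)) (ψ f : E d → ℂ) (h : H) :
    (fun x => waveletTransform H ψ f x h) =
      (f ⋆[ContinuousLinearMap.mul ℂ ℂ] waveletKernel ψ (h : GLd d)) := by
  funext x
  simp [waveletTransform, convolution_def, waveletKernel, quasiRegFun]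

theorem integrable_waveletKernel {ψ : E d → ℂ} (hψ : Integrable ψ) (h : GLd d) :
    Integrable (waveletKernel ψ h) := by
  have h1 : Integrable fun z => ψ (act h⁻¹ (-z)) := (integrable_comp_act h⁻¹ hψ).comp_neg
  exact (Complex.conjLIE.integrable_comp_iff.2 h1).const_mul _

/-- The substitution `z = -hu` produces `|det h|`, which turns the normalisation `|det h|^{-1/2}`
into `|det h|^{1/2}`; the reflection lets the conjugate pass outside the transform. -/
theorem fourier_waveletKernel (ψ : E d → ℂ) (h : GLd d) (ξ : E d) :
    𝓕 (waveletKernel ψ h) ξ =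
      ((absDet h ^ (1 / 2 : ℝ) : ℝ) : ℂ) * conj (𝓕 ψ (dualAct h ξ)) := by
  have hp := absDet_pos h
  rw [Real.fourier_eq, ← integral_neg_eq_self, integral_comp_act h, Real.fourier_eq, ← integral_conj]
  simp only [waveletKernel, neg_neg, act_inv_act]
  have e : ∀ u : E d, Real.fourierChar (-inner ℝ (-(act h u)) ξ) •
      (((absDet h ^ (-(1 / 2) : ℝ) : ℝ) : ℂ) * conj (ψ u)) =
      ((absDet h ^ (-(1 / 2) : ℝ) : ℝ) : ℂ) *
        conj (Real.fourierChar (-inner ℝ u (dualAct h ξ)) • ψ u) := by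
    intro u
    rw [inner_neg_left, neg_neg, inner_act, Circle.smul_def, Circle.smul_def, smul_eq_mul,
      smul_eq_mul, map_mul, ← Circle.coe_inv_eq_conj, ← AddChar.map_neg_eq_inv, neg_neg]
    ring
  simp only [e]
  rw [integral_const_mul, ← mul_assoc]
  congr 1
  rw [← Complex.ofReal_mul]
  congr 1
  nth_rewrite 1 [← Real.rpow_one (absDet h)]
  rw [← Real.rpow_add hp]
  norm_num

/-- The product of which the wavelet coefficients are the inverse Fourier transform. -/
def spectralProduct (f ψ : E d → ℂ) (h : GLd d) (ξ : E d) : ℂ :=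
  𝓕 f ξ * conj (𝓕 ψ (dualAct h ξ))

theorem waveletTransform_ae_eq {H : Subgroup (GLd d)} {f ψ : E d → ℂ} (hf : Integrable f)
    (hψ : Integrable ψ) (h : H) (hP : Integrable (spectralProduct f ψ (h : GLd d))) :
    ∀ᵐ x : E d, waveletTransform H ψ f x h =
      ((absDet (h : GLd d) ^ (1 / 2 : ℝ) : ℝ) : ℂ) *
        𝓕 (spectralProduct f ψ (h : GLd d)) (-x) := by
  have hK := integrable_waveletKernel hψ (h : GLd d)
  have hW : Integrable fun x => waveletTransform H ψ f x h := by
    rw [waveletTransform_eq_convolution]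
    exact hf.integrable_convolution _ hK
  have hFW : 𝓕 (fun x => waveletTransform H ψ f x h) =
      fun ξ => ((absDet (h : GLd d) ^ (1 / 2 : ℝ) : ℝ) : ℂ) • spectralProduct f ψ (h : GLd d) ξ := by
    funext ξ
    rw [waveletTransform_eq_convolution, Real.fourier_mul_convolution_eq hf hK,
      fourier_waveletKernel, spectralProduct, smul_eq_mul]
    ring
  have hFWi : Integrable (𝓕 (fun x => waveletTransform H ψ f x h)) := by
    rw [hFW]
    exact hP.const_mul _
  filter_upwards [ae_eq_fourierInv_fourier hW hFWi] with x hx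
  rw [hx, hFW, Real.fourierInv_eq_fourier_neg, Real.fourier_eq, Real.fourier_eq,
    ← integral_const_mul]
  congr 1 with y
  simp only [smul_eq_mul, Circle.smul_def]
  ring

/-! ### Pointwise decay of wavelet coefficients -/

theorem continuous_auxA (O : Set (E d)) : Continuous (auxA O) := by
  unfold auxA
  have h1 : Continuous fun ξ => Metric.infDist ξ Oᶜ := Metric.continuous_infDist_pt _
  refine Continuous.min (h1.div ?_ fun ξ => ?_) (continuous_const.div (by fun_prop) fun ξ => ?_)
  · fun_prop
  · positivity
  · positivity

/-- The integrand of the overlap integral of `O`. -/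
def overlap (O : Set (E d)) (ℓ : ℕ) (h : GLd d) (ξ : E d) : ℝ :=
  auxA O ξ ^ ℓ * auxA O (dualAct h ξ) ^ ℓ

theorem continuous_overlap (O : Set (E d)) (ℓ : ℕ) (h : GLd d) : Continuous (overlap O ℓ h) :=
  ((continuous_auxA O).pow ℓ).mul (((continuous_auxA O).comp (dualAct h).continuous).pow ℓ)

theorem overlap_nonneg (O : Set (E d)) (ℓ : ℕ) (h : GLd d) (ξ : E d) : 0 ≤ overlap O ℓ h ξ :=
  mul_nonneg (pow_nonneg (auxA_nonneg _ _) _) (pow_nonneg (auxA_nonneg _ _) _)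

theorem norm_iteratedFDeriv_conj_comp_le {Ψ : E d → ℂ} {m n : ℕ} (hΨ : ContDiff ℝ m Ψ)
    (hn : n ≤ m) (T : E d →L[ℝ] E d) (ξ : E d) :
    ‖iteratedFDeriv ℝ n (fun ξ => conj (Ψ (T ξ))) ξ‖ ≤
      (1 + ‖T‖) ^ m * ‖iteratedFDeriv ℝ n Ψ (T ξ)‖ := by
  have e : (fun ξ => conj (Ψ (T ξ))) = Complex.conjLIE ∘ (Ψ ∘ T) := rfl
  rw [e, LinearIsometryEquiv.norm_iteratedFDeriv_comp_left,
    ContinuousLinearMap.iteratedFDeriv_comp_right T hΨ ξ (by exact_mod_cast hn)]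
  refine (ContinuousMultilinearMap.norm_compContinuousLinearMap_le _ _).trans ?_
  rw [mul_comm]
  gcongr
  rw [Finset.prod_const, Finset.card_univ, Fintype.card_fin]
  calc ‖T‖ ^ n ≤ (1 + ‖T‖) ^ n := by gcongr; linarith
    _ ≤ (1 + ‖T‖) ^ m := pow_le_pow_right₀ (by linarith [norm_nonneg T]) hn

theorem norm_iteratedFDeriv_mul_conj_comp_le {F Ψ : E d → ℂ} {m n : ℕ} (hF : ContDiff ℝ m F)
    (hΨ : ContDiff ℝ m Ψ) (hn : n ≤ m) (T : E d →L[ℝ] E d) (ξ : E d) {a b : ℝ} (ha : 0 ≤ a)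
    (hFa : ∀ i ≤ m, ‖iteratedFDeriv ℝ i F ξ‖ ≤ a)
    (hΨb : ∀ i ≤ m, ‖iteratedFDeriv ℝ i Ψ (T ξ)‖ ≤ b) :
    ‖iteratedFDeriv ℝ n (fun ξ => F ξ * conj (Ψ (T ξ))) ξ‖ ≤
      2 ^ m * (1 + ‖T‖) ^ m * (a * b) := by
  have hb : 0 ≤ b := (norm_nonneg _).trans (hΨb 0 (Nat.zero_le _))
  have hΨ' : ContDiff ℝ m (fun ξ => conj (Ψ (T ξ))) :=
    Complex.conjLIE.contDiff.comp (hΨ.comp T.contDiff)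
  refine (norm_iteratedFDeriv_mul_le hF hΨ' ξ (by exact_mod_cast hn)).trans ?_
  have hi : ∀ i ∈ Finset.range (n + 1), (n.choose i : ℝ) * ‖iteratedFDeriv ℝ i F ξ‖ *
      ‖iteratedFDeriv ℝ (n - i) (fun ξ => conj (Ψ (T ξ))) ξ‖ ≤
        (n.choose i : ℝ) * ((1 + ‖T‖) ^ m * (a * b)) := by
    intro i hi
    have hin : i ≤ n := Nat.lt_succ_iff.1 (Finset.mem_range.1 hi)
    have h2 := (norm_iteratedFDeriv_conj_comp_le hΨ ((Nat.sub_le n i).trans hn) T ξ).trans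
      (mul_le_mul_of_nonneg_left (hΨb (n - i) (by omega)) (by positivity))
    rw [mul_assoc]
    refine mul_le_mul_of_nonneg_left ?_ (by positivity)
    refine (mul_le_mul (hFa i (hin.trans hn)) h2 (norm_nonneg _) ha).trans (le_of_eq ?_)
    ring
  refine (Finset.sum_le_sum hi).trans ?_
  rw [← Finset.sum_mul, mul_assoc]
  refine mul_le_mul_of_nonneg_right ?_ (by positivity)
  have : (∑ i ∈ Finset.range (n + 1), (n.choose i : ℝ)) = 2 ^ n := by
    exact_mod_cast Nat.sum_range_choose n
  rw [this]
  exact pow_le_pow_right₀ (by norm_num) hn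

theorem one_add_pow_le (r : ℝ) (hr : 0 ≤ r) (m : ℕ) : (1 + r) ^ m ≤ 2 ^ m * (1 + r ^ m) := by
  rcases le_total r 1 with h | h
  · calc (1 + r) ^ m ≤ 2 ^ m := by gcongr; linarith
      _ ≤ 2 ^ m * (1 + r ^ m) := le_mul_of_one_le_right (by positivity) (by linarith [pow_nonneg hr m])
  · calc (1 + r) ^ m ≤ (2 * r) ^ m := by gcongr; linarith
      _ = 2 ^ m * r ^ m := mul_pow _ _ _
      _ ≤ 2 ^ m * (1 + r ^ m) := by gcongr; linarith

/-- Decay of the Fourier transform of a function with dominated derivatives. -/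
theorem one_add_norm_pow_mul_norm_fourier_le {P : E d → ℂ} {m : ℕ} (hP : ContDiff ℝ m P)
    {B : E d → ℝ} (hB : Integrable B)
    (hPB : ∀ n ≤ m, ∀ ξ, ‖iteratedFDeriv ℝ n P ξ‖ ≤ B ξ) (x : E d) :
    (1 + ‖x‖) ^ m * ‖𝓕 P x‖ ≤ 2 ^ (2 * m + 1) * (m + 1) * ∫ ξ, B ξ := by
  have hB0 : ∀ ξ, 0 ≤ B ξ := fun ξ => (norm_nonneg _).trans (hPB 0 (Nat.zero_le _) ξ)
  have hI0 : 0 ≤ ∫ ξ, B ξ := integral_nonneg hB0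
  have hint : ∀ n ≤ m, Integrable fun ξ => ‖iteratedFDeriv ℝ n P ξ‖ := by
    intro n hn
    refine hB.mono' ?_ (Filter.Eventually.of_forall fun ξ => by simpa using hPB n hn ξ)
    exact (hP.continuous_iteratedFDeriv (by exact_mod_cast hn)).norm.aestronglyMeasurable
  -- With no derivative on the Fourier side, the general estimate is `2^n` times a sum of `n + 1`
  -- integrals, each at most `∫ B`. The cases `n = 0` and `n = m` suffice.
  have key : ∀ n ≤ m, ‖x‖ ^ n * ‖𝓕 P x‖ ≤ 2 ^ m * (m + 1) * ∫ ξ, B ξ := by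
    intro n hn
    have h1 := Real.pow_mul_norm_iteratedFDeriv_fourier_le (K := 0) (N := m) (k := 0) (n := n)
      (f := P) (by exact_mod_cast hP) (by
        intro k n hk hn
        have hk0 : k = 0 := by simpa using hk
        subst hk0
        simpa using hint n (by exact_mod_cast hn)) le_rfl (by exact_mod_cast hn) x
    simp only [norm_iteratedFDeriv_zero] at h1
    refine h1.trans ?_
    have h2 : ∀ p ∈ Finset.range (0 + 1) ×ˢ Finset.range (n + 1),
        ∫ v, ‖v‖ ^ p.1 * ‖iteratedFDeriv ℝ p.2 P v‖ ≤ ∫ ξ, B ξ := by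
      intro p hp
      simp only [Finset.mem_product, Finset.mem_range] at hp
      have hp0 : p.1 = 0 := by omega
      simp only [hp0, pow_zero, one_mul]
      exact integral_mono (hint _ (by omega)) hB fun ξ => hPB _ (by omega) ξ
    refine (mul_le_mul_of_nonneg_left (Finset.sum_le_sum h2) (by positivity)).trans ?_
    simp only [Finset.sum_const, Finset.card_product, Finset.card_range, nsmul_eq_mul]
    have h3 : (2 : ℝ) ^ n ≤ 2 ^ m := pow_le_pow_right₀ (by norm_num) hn
    have h4 : (n : ℝ) ≤ m := by exact_mod_cast hn
    push_cast
    simp only [pow_zero, mul_zero, zero_add, one_mul, ← mul_assoc]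
    gcongr
  have h0 := key 0 (Nat.zero_le _)
  have hm := key m le_rfl
  rw [pow_zero, one_mul] at h0
  calc (1 + ‖x‖) ^ m * ‖𝓕 P x‖ ≤ 2 ^ m * (1 + ‖x‖ ^ m) * ‖𝓕 P x‖ := by
        gcongr
        exact one_add_pow_le _ (norm_nonneg x) m
    _ = 2 ^ m * (‖𝓕 P x‖ + ‖x‖ ^ m * ‖𝓕 P x‖) := by ring
    _ ≤ 2 ^ m * (2 ^ m * (m + 1) * (∫ ξ, B ξ) + 2 ^ m * (m + 1) * ∫ ξ, B ξ) := by gcongr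
    _ = 2 ^ (2 * m + 1) * (m + 1) * ∫ ξ, B ξ := by ring

/-- The constant in the pointwise bound for wavelet coefficients. -/
def decayConst (d t m : ℕ) : ℝ := 2 ^ (2 * m + 1) * (m + 1) * (2 ^ m * d ^ (4 * t))

/-- Since `m + ℓ ≤ t`, up to `m` derivatives leave the power `ℓ` of `auxA` on both factors of the
spectral product. All its derivatives are then dominated by the overlap integrand, and Fourier decay
applies. -/
theorem norm_waveletTransform_le (hd : 1 ≤ d) {H : Subgroup (GLd d)} {O : Set (E d)}
    (hO : IsOpenDualOrbit H O) {t ℓ m : ℕ} (hm : m + ℓ ≤ t) {f ψ : E d → ℂ}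
    (hf : Integrable f) (hψ : Integrable ψ) (hF : FlatOn Oᶜ t (𝓕 f)) (hΨ : FlatOn Oᶜ t (𝓕 ψ))
    {N M : ℝ}
    (hN : ∀ (x : E d) (α : Fin d → ℕ), ∑ i, α i ≤ t →
      (1 + ‖x‖) ^ t * ‖multiDeriv α (𝓕 f) x‖ ≤ N)
    (hM : ∀ (x : E d) (α : Fin d → ℕ), ∑ i, α i ≤ t →
      (1 + ‖x‖) ^ t * ‖multiDeriv α (𝓕 ψ) x‖ ≤ M)
    (h : H) (hB : Integrable (overlap O ℓ (h : GLd d))) :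
    ∀ᵐ x : E d, (1 + ‖x‖) ^ m * ‖waveletTransform H ψ f x h‖ ≤
      decayConst d t m * (N * M) * (absDet (h : GLd d) ^ (1 / 2 : ℝ) *
        (1 + opNorm (h : GLd d)) ^ m * ∫ ξ, overlap O ℓ (h : GLd d) ξ) := by
  have hN0 : 0 ≤ N := le_trans (by positivity) (hN 0 0 (by simp))
  have hM0 : 0 ≤ M := le_trans (by positivity) (hM 0 0 (by simp))
  have hFc : ContDiff ℝ m (𝓕 f) := by
    simpa [multiDeriv_zero] using hF.contDiff m 0 (by simp; omega)
  have hΨc : ContDiff ℝ m (𝓕 ψ) := by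
    simpa [multiDeriv_zero] using hΨ.contDiff m 0 (by simp; omega)
  set T := dualAct (h : GLd d) with hT
  have hP : ContDiff ℝ m (spectralProduct f ψ (h : GLd d)) :=
    hFc.mul (Complex.conjLIE.contDiff.comp (hΨc.comp T.contDiff))
  -- `2^m` comes from the Leibniz rule, `(1+‖T‖)^m` from the chain rule, and `d^{4t}` from the
  -- flatness bounds of the two factors.
  set c : ℝ := 2 ^ m * (1 + ‖T‖) ^ m * (d ^ (4 * t) * (N * M)) with hc
  have hPB : ∀ n ≤ m, ∀ ξ, ‖iteratedFDeriv ℝ n (spectralProduct f ψ (h : GLd d)) ξ‖ ≤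
      c * overlap O ℓ (h : GLd d) ξ := by
    intro n hn ξ
    have := norm_iteratedFDeriv_mul_conj_comp_le hFc hΨc hn T ξ
      (a := d ^ (2 * t) * N * auxA O ξ ^ ℓ) (b := d ^ (2 * t) * M * auxA O (T ξ) ^ ℓ)
      (by have := auxA_nonneg O ξ; positivity)
      (fun i hi => hF.norm_iteratedFDeriv_le_auxA hd hO hN ξ (by omega))
      (fun i hi => hΨ.norm_iteratedFDeriv_le_auxA hd hO hM (T ξ) (by omega))
    refine this.trans (le_of_eq ?_)
    rw [hc, overlap, ← hT]
    ring
  have hPi : Integrable (spectralProduct f ψ (h : GLd d)) := by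
    refine (hB.const_mul c).mono' hP.continuous.aestronglyMeasurable
      (Filter.Eventually.of_forall fun ξ => ?_)
    simpa using hPB 0 (Nat.zero_le _) ξ
  filter_upwards [waveletTransform_ae_eq hf hψ h hPi] with x hx
  have hdet : 0 ≤ absDet (h : GLd d) ^ (1 / 2 : ℝ) := Real.rpow_nonneg (absDet_pos _).le _
  have key := one_add_norm_pow_mul_norm_fourier_le hP (hB.const_mul c) hPB (-x)
  rw [norm_neg, integral_const_mul] at key
  rw [hx, norm_mul, Complex.norm_real, Real.norm_of_nonneg hdet]
  calc (1 + ‖x‖) ^ m * (absDet (h : GLd d) ^ (1 / 2 : ℝ) *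
          ‖𝓕 (spectralProduct f ψ (h : GLd d)) (-x)‖)
      = absDet (h : GLd d) ^ (1 / 2 : ℝ) *
          ((1 + ‖x‖) ^ m * ‖𝓕 (spectralProduct f ψ (h : GLd d)) (-x)‖) := by ring
    _ ≤ absDet (h : GLd d) ^ (1 / 2 : ℝ) * (2 ^ (2 * m + 1) * (m + 1) *
          (c * ∫ ξ, overlap O ℓ (h : GLd d) ξ)) := by gcongr
    _ = _ := by
      rw [hc, ← norm_dualAct, ← hT, decayConst]
      ring

/-! ### Topology of linear groups -/

theorem secondCountableTopology_GLd : SecondCountableTopology (GLd d) := by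
  have h1 : SecondCountableTopology (Matrix (Fin d) (Fin d) ℝ) :=
    inferInstanceAs (SecondCountableTopology (Fin d → Fin d → ℝ))
  have h2 : SecondCountableTopology (Matrix (Fin d) (Fin d) ℝ)ᵐᵒᵖ :=
    MulOpposite.opHomeomorph.symm.secondCountableTopology
  exact Units.isEmbedding_embedProduct.secondCountableTopology

theorem locallyCompactSpace_GLd : LocallyCompactSpace (GLd d) := by
  have h1 : LocallyCompactSpace (Matrix (Fin d) (Fin d) ℝ) :=
    inferInstanceAs (LocallyCompactSpace (Fin d → Fin d → ℝ))
  infer_instance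

theorem continuous_toEuclideanCLM :
    Continuous (Matrix.toEuclideanCLM (n := Fin d) (𝕜 := ℝ)) := by
  exact LinearMap.continuous_of_finiteDimensional
    ((Matrix.toEuclideanCLM (n := Fin d) (𝕜 := ℝ)).toAlgEquiv.toLinearMap)

theorem continuous_act : Continuous (act (d := d)) :=
  continuous_toEuclideanCLM.comp Units.continuous_val

theorem continuous_dualAct : Continuous (dualAct (d := d)) :=
  continuous_toEuclideanCLM.comp Units.continuous_val.matrix_transpose

theorem continuous_absDet : Continuous (absDet (d := d)) :=
  (Units.continuous_val.matrix_det).abs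

theorem continuous_opNorm : Continuous (opNorm (d := d)) := continuous_act.norm

/-! ### Young's inequality and right translates of Haar measure -/

section Group

variable {G : Type*} [Group G] [MeasurableSpace G]

/-- Hölder's inequality for the splitting `b c = b^{1/q'} · (b^{1/q} c)`, where `q'` is the
conjugate exponent. -/
theorem lintegral_mul_rpow_le {X : Type*} [MeasurableSpace X] (μ : Measure X) {b c : X → ℝ≥0∞}
    (hb : Measurable b) (hc : Measurable c) {q : ℝ} (hq : 1 ≤ q) :
    (∫⁻ x, b x * c x ∂μ) ^ q ≤ (∫⁻ x, b x ∂μ) ^ (q - 1) * ∫⁻ x, b x * c x ^ q ∂μ := by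
  rcases hq.eq_or_lt with rfl | hq1
  · simp
  have hpq := (Real.HolderConjugate.conjExponent hq1).symm
  set q' := q.conjExponent with hq'
  have hq0 : 0 < q := by linarith
  have hq'0 : 0 < q' := hpq.pos
  have hsum : 1 / q' + 1 / q = 1 := by
    have := hpq.inv_add_inv_eq_one
    simpa [one_div] using this
  have h1 := ENNReal.lintegral_mul_le_Lp_mul_Lq μ hpq (f := fun x => b x ^ (1 / q'))
    (g := fun x => b x ^ (1 / q) * c x) (hb.pow_const _).aemeasurable
    ((hb.pow_const _).mul hc).aemeasurable
  have e1 : ∀ x, b x ^ (1 / q') * (b x ^ (1 / q) * c x) = b x * c x := by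
    intro x
    rw [← mul_assoc, ← ENNReal.rpow_add_of_nonneg _ _ (by positivity) (by positivity), hsum,
      ENNReal.rpow_one]
  have e2 : ∀ x, (b x ^ (1 / q')) ^ q' = b x := by
    intro x
    rw [← ENNReal.rpow_mul, one_div_mul_cancel hq'0.ne', ENNReal.rpow_one]
  have e3 : ∀ x, (b x ^ (1 / q) * c x) ^ q = b x * c x ^ q := by
    intro x
    rw [ENNReal.mul_rpow_of_nonneg _ _ hq0.le, ← ENNReal.rpow_mul, one_div_mul_cancel hq0.ne',
      ENNReal.rpow_one]
  simp only [Pi.mul_apply, e1, e2, e3] at h1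
  refine (ENNReal.rpow_le_rpow h1 hq0.le).trans (le_of_eq ?_)
  rw [ENNReal.mul_rpow_of_nonneg _ _ hq0.le, ← ENNReal.rpow_mul, ← ENNReal.rpow_mul,
    one_div_mul_cancel hq0.ne', ENNReal.rpow_one]
  congr 2
  have : 1 / q' = 1 - 1 / q := by linarith
  rw [this, sub_mul, one_div_mul_cancel hq0.ne', one_mul]

/-- Young's inequality `‖b * c‖_q ≤ ‖b‖₁ ‖c‖_q` on a group. -/
theorem lintegral_convolution_rpow_le [MeasurableMul₂ G] [MeasurableInv G] (μ : Measure G)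
    [SFinite μ] [μ.IsMulLeftInvariant] {b c : G → ℝ≥0∞} (hb : Measurable b) (hc : Measurable c)
    {q : ℝ} (hq : 1 ≤ q) :
    ∫⁻ h, (∫⁻ k, b k * c (k⁻¹ * h) ∂μ) ^ q ∂μ ≤ (∫⁻ k, b k ∂μ) ^ q * ∫⁻ h, c h ^ q ∂μ := by
  have hq0 : 0 < q := by linarith
  calc ∫⁻ h, (∫⁻ k, b k * c (k⁻¹ * h) ∂μ) ^ q ∂μ
      ≤ ∫⁻ h, (∫⁻ k, b k ∂μ) ^ (q - 1) * ∫⁻ k, b k * c (k⁻¹ * h) ^ q ∂μ ∂μ := by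
        refine lintegral_mono fun h => ?_
        exact lintegral_mul_rpow_le μ hb (by fun_prop) hq
    _ = (∫⁻ k, b k ∂μ) ^ (q - 1) * ∫⁻ h, ∫⁻ k, b k * c (k⁻¹ * h) ^ q ∂μ ∂μ := by
        rw [lintegral_const_mul]
        refine Measurable.lintegral_prod_right' (f := fun p : G × G => b p.2 * c (p.2⁻¹ * p.1) ^ q) ?_
        fun_prop
    _ = (∫⁻ k, b k ∂μ) ^ (q - 1) * ∫⁻ k, ∫⁻ h, b k * c (k⁻¹ * h) ^ q ∂μ ∂μ := by
        rw [lintegral_lintegral_swap]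
        refine Measurable.aemeasurable ?_
        simp only [Function.uncurry_def]
        fun_prop
    _ = (∫⁻ k, b k ∂μ) ^ (q - 1) * ((∫⁻ k, b k ∂μ) * ∫⁻ h, c h ^ q ∂μ) := by
        congr 1
        rw [← lintegral_mul_const _ hb]
        refine lintegral_congr fun k => ?_
        rw [lintegral_const_mul _ (by fun_prop), lintegral_mul_left_eq_self (fun h => c h ^ q) k⁻¹]
    _ = (∫⁻ k, b k ∂μ) ^ q * ∫⁻ h, c h ^ q ∂μ := by
        rw [← mul_assoc]
        congr 1
        nth_rewrite 2 [← ENNReal.rpow_one (∫⁻ k, b k ∂μ)]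
        rw [← ENNReal.rpow_add_of_nonneg _ _ (by linarith) zero_le_one, sub_add_cancel]

variable [TopologicalSpace G] [IsTopologicalGroup G] [LocallyCompactSpace G]
  [SecondCountableTopology G] [BorelSpace G]

open scoped Pointwise in
/-- Right translation by elements of a compact set distorts a Haar measure by a bounded factor. -/
theorem exists_lintegral_mul_right_le (μ : Measure G) [μ.IsHaarMeasure] {K : Set G}
    (hK : IsCompact K) (hK1 : K ∈ nhds (1 : G)) :
    ∃ C : ℝ≥0∞, C ≠ ⊤ ∧ ∀ k ∈ K, ∀ T : G → ℝ≥0∞, Measurable T →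
      ∫⁻ g, T (g * k⁻¹) ∂μ ≤ C * ∫⁻ g, T g ∂μ := by
  have hpos : 0 < μ K := Measure.measure_pos_of_mem_nhds μ hK1
  have hfin : μ K ≠ ⊤ := hK.measure_lt_top.ne
  refine ⟨μ (closure (K * K)) / μ K, ?_, fun k hk T hT => ?_⟩
  · exact ENNReal.div_ne_top (hK.mul hK).closure.measure_lt_top.ne hpos.ne'
  -- The right translate of `μ` is again left invariant, hence `Δ μ`. Evaluating on `K` gives `Δ
  -- μ(K) = μ(Kk) ≤ μ(KK)`, uniformly in `k ∈ K`.
  set Δ : ℝ≥0 := Measure.haarScalarFactor (Measure.map (· * k⁻¹) μ) μ with hΔ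
  have hmap : Measure.map (· * k⁻¹) μ = Δ • μ := Measure.isMulLeftInvariant_eq_smul _ μ
  have h1 : ∫⁻ g, T (g * k⁻¹) ∂μ = Δ * ∫⁻ g, T g ∂μ := by
    rw [← lintegral_map hT (by fun_prop : Measurable fun g : G => g * k⁻¹), hmap,
      lintegral_smul_measure]
    rfl
  rw [h1]
  gcongr
  rw [ENNReal.le_div_iff_mul_le (Or.inl hpos.ne') (Or.inl hfin)]
  have h2 : (Δ : ℝ≥0∞) * μ K = Measure.map (· * k⁻¹) μ K := by
    rw [hmap]
    rfl
  rw [h2, show (fun g : G => g * k⁻¹) = MeasurableEquiv.mulRight k⁻¹ from rfl,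
    MeasurableEquiv.map_apply]
  refine measure_mono fun g hg => subset_closure ?_
  exact ⟨g * k⁻¹, hg, k, hk, by simp⟩

end Group

/-! ### Integration over an open orbit -/

theorem continuous_dualAct_uncurry {H : Subgroup (GLd d)} :
    Continuous fun p : H × E d => dualAct (p.1 : GLd d) p.2 :=
  (continuous_dualAct.comp (continuous_subtype_val.comp continuous_fst)).clm_apply continuous_snd

theorem continuous_orbitMap {H : Subgroup (GLd d)} (ξ : E d) :
    Continuous fun h : H => dualAct (h : GLd d) ξ :=
  (continuous_dualAct.comp continuous_subtype_val).clm_apply continuous_const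

theorem continuous_absDet_coe {H : Subgroup (GLd d)} : Continuous fun h : H => absDet (h : GLd d) :=
  continuous_absDet.comp continuous_subtype_val

theorem continuous_inv_absDet_coe {H : Subgroup (GLd d)} :
    Continuous fun h : H => (absDet (h : GLd d))⁻¹ :=
  continuous_absDet_coe.inv₀ fun h => (absDet_pos (h : GLd d)).ne'

section Orbit

variable {H : Subgroup (GLd d)} [MeasurableSpace H] [BorelSpace H]

theorem measurable_ofReal_inv_absDet :
    Measurable fun k : H => ENNReal.ofReal (absDet (k : GLd d))⁻¹ :=
  continuous_inv_absDet_coe.measurable.ennreal_ofReal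

variable [SecondCountableTopology H]

theorem measurable_dualAct_swap : Measurable fun p : E d × H => dualAct (p.2 : GLd d) p.1 :=
  (continuous_dualAct_uncurry.comp continuous_swap).measurable

theorem measurable_dualAct_inv_swap :
    Measurable fun p : E d × H => dualAct (p.2 : GLd d)⁻¹ p.1 :=
  ((continuous_dualAct.comp (continuous_inv.comp
    (continuous_subtype_val.comp continuous_snd))).clm_apply continuous_fst).measurable

/-- The integral of `F` against the image of the measure `|det k|⁻¹ dμ(k)` under `k ↦ k⁻ᵀ η`. -/
def orbitIntegral (μ : Measure H) (F : E d → ℝ≥0∞) (η : E d) : ℝ≥0∞ :=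
  ∫⁻ k : H, F (dualAct (k : GLd d)⁻¹ η) * ENNReal.ofReal (absDet (k : GLd d))⁻¹ ∂μ

theorem measurable_orbitIntegrand {F : E d → ℝ≥0∞} (hF : Measurable F) (η : E d) :
    Measurable fun k : H => F (dualAct (k : GLd d)⁻¹ η) *
      ENNReal.ofReal (absDet (k : GLd d))⁻¹ :=
  (hF.comp (measurable_dualAct_inv_swap.comp (measurable_const.prodMk measurable_id))).mul
    measurable_ofReal_inv_absDet

/-- Tonelli's theorem around the substitution `η = gᵀξ`, whose Jacobian supplies the density `|det
g|⁻¹` of the orbit integral. -/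
theorem lintegral_lintegral_dualAct (μ : Measure H) [SFinite μ] {F φ : E d → ℝ≥0∞}
    (hF : Measurable F) (hφ : Measurable φ) :
    ∫⁻ ξ, ∫⁻ g : H, F ξ * φ (dualAct (g : GLd d) ξ) ∂μ = ∫⁻ η, φ η * orbitIntegral μ F η := by
  have hin : ∀ g : H, ∫⁻ ξ, F ξ * φ (dualAct (g : GLd d) ξ) =
      ∫⁻ η, φ η * (F (dualAct (g : GLd d)⁻¹ η) * ENNReal.ofReal (absDet (g : GLd d))⁻¹) := by
    intro g
    have hm : Measurable fun η => F (dualAct (g : GLd d)⁻¹ η) * φ η :=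
      (hF.comp (dualAct (g : GLd d)⁻¹).continuous.measurable).mul hφ
    have := lintegral_comp_dualAct (g : GLd d) hm
    simp only [dualAct_inv_dualAct] at this
    rw [this, ← lintegral_const_mul _ hm]
    refine lintegral_congr fun η => ?_
    ring
  rw [lintegral_lintegral_swap]
  · simp only [hin]
    rw [lintegral_lintegral_swap]
    · refine lintegral_congr fun η => ?_
      rw [lintegral_const_mul _ (measurable_orbitIntegrand hF η), orbitIntegral]
    · refine Measurable.aemeasurable ?_
      exact (hφ.comp measurable_snd).mul
        (((hF.comp measurable_dualAct_inv_swap).comp measurable_swap).mul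
          (measurable_ofReal_inv_absDet.comp measurable_fst))
  · refine Measurable.aemeasurable ?_
    exact (hF.comp measurable_fst).mul (hφ.comp measurable_dualAct_swap)

/-- As `g⁻ᵀkᵀξ₀ = (gk⁻¹)⁻ᵀξ₀`, moving the base point is a right translation of the integrand, and
`C` measures how that translation distorts `μ`. -/
theorem orbitIntegral_dualAct_le (μ : Measure H) {F : E d → ℝ≥0∞} (hF : Measurable F) (k : H)
    {C : ℝ≥0∞} (hC : ∀ T : H → ℝ≥0∞, Measurable T → ∫⁻ g, T (g * k⁻¹) ∂μ ≤ C * ∫⁻ g, T g ∂μ)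
    (ξ₀ : E d) :
    orbitIntegral μ F (dualAct (k : GLd d) ξ₀) ≤
      ENNReal.ofReal (absDet (k : GLd d))⁻¹ * (C * orbitIntegral μ F ξ₀) := by
  have hTm := measurable_orbitIntegrand (H := H) hF ξ₀
  have hk0 := absDet_pos (k : GLd d)
  have e : ∀ g : H, F (dualAct (g : GLd d)⁻¹ (dualAct (k : GLd d) ξ₀)) *
      ENNReal.ofReal (absDet (g : GLd d))⁻¹ =
      ENNReal.ofReal (absDet (k : GLd d))⁻¹ *
        (F (dualAct ((g * k⁻¹ : H) : GLd d)⁻¹ ξ₀) *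
          ENNReal.ofReal (absDet ((g * k⁻¹ : H) : GLd d))⁻¹) := by
    intro g
    have hg0 := absDet_pos (g : GLd d)
    rw [Subgroup.coe_mul, Subgroup.coe_inv, mul_inv_rev, inv_inv, dualAct_mul, absDet_mul,
      absDet_inv, mul_left_comm, ← ENNReal.ofReal_mul (by positivity)]
    congr 2
    rw [mul_inv, inv_inv, mul_left_comm, inv_mul_cancel₀ hk0.ne', mul_one]
  have hTm' : Measurable fun g : H => F (dualAct ((g * k⁻¹ : H) : GLd d)⁻¹ ξ₀) *
      ENNReal.ofReal (absDet ((g * k⁻¹ : H) : GLd d))⁻¹ := hTm.comp (measurable_mul_const k⁻¹)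
  rw [orbitIntegral, lintegral_congr e, lintegral_const_mul _ hTm']
  gcongr
  exact hC _ hTm

variable [LocallyCompactSpace H]

/-- Lebesgue measure on an open orbit is dominated by the image of a Haar measure. -/
theorem exists_lintegral_orbit_le (μ : Measure H) [μ.IsHaarMeasure] {O : Set (E d)}
    (hO : IsOpenDualOrbit H O) {ξ₀ : E d} (hξ₀ : ξ₀ ∈ O) :
    ∃ C : ℝ≥0∞, C ≠ ⊤ ∧ ∀ F : E d → ℝ≥0∞, Measurable F →
      ∫⁻ ξ in O, F ξ ≤ C * orbitIntegral μ F ξ₀ := by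
  obtain ⟨K, hK, hK1⟩ := exists_compact_mem_nhds (1 : H)
  obtain ⟨C₁, hC₁, hright⟩ := exists_lintegral_mul_right_le μ hK hK1
  obtain ⟨C₂, hC₂⟩ := hK.exists_bound_of_continuousOn
    (continuous_inv_absDet_coe (H := H)).continuousOn
  have hpos : 0 < μ K := Measure.measure_pos_of_mem_nhds μ hK1
  have hfin : μ K ≠ ⊤ := hK.measure_lt_top.ne
  -- With `φ` the indicator of `S`, left invariance gives `∫ φ(gᵀξ) dμ(g) ≥ μ(K)` for every `ξ ∈ O`.
  -- Inserting this average and exchanging integrals leaves `∫ φ · orbitIntegral`, which only sees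
  -- base points in the compact set `S`, where the orbit integral is at most a constant times its
  -- value at `ξ₀`.
  obtain ⟨S, hS⟩ : ∃ S : Set (E d), S = (fun k : H => dualAct (k : GLd d) ξ₀) '' K := ⟨_, rfl⟩
  have hSc : IsCompact S := hS ▸ hK.image (continuous_orbitMap ξ₀)
  have hSm : MeasurableSet S := hSc.isClosed.measurableSet
  obtain ⟨φ, hφ⟩ : ∃ φ : E d → ℝ≥0∞, φ = S.indicator 1 := ⟨_, rfl⟩
  have hφm : Measurable φ := hφ ▸ measurable_one.indicator hSm
  refine ⟨(μ K)⁻¹ * (volume S * (ENNReal.ofReal C₂ * C₁)), ?_, fun F hF => ?_⟩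
  · refine ENNReal.mul_ne_top (ENNReal.inv_ne_top.2 hpos.ne') ?_
    exact ENNReal.mul_ne_top hSc.measure_lt_top.ne (ENNReal.mul_ne_top ENNReal.ofReal_ne_top hC₁)
  have hKφ : μ K ≤ ∫⁻ g : H, φ (dualAct (g : GLd d) ξ₀) ∂μ := by
    rw [← lintegral_indicator_one hK.isClosed.measurableSet]
    refine lintegral_mono fun g => ?_
    by_cases hg : g ∈ K
    · have : dualAct (g : GLd d) ξ₀ ∈ S := hS ▸ ⟨g, hg, rfl⟩
      simp [hφ, hg, this]
    · simp [hg]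
  have hA : μ K * ∫⁻ ξ in O, F ξ ≤ ∫⁻ ξ in O, ∫⁻ g : H, F ξ * φ (dualAct (g : GLd d) ξ) ∂μ := by
    rw [← lintegral_const_mul _ hF]
    refine setLIntegral_mono' hO.1.measurableSet fun ξ hξ => ?_
    obtain ⟨k, rfl⟩ := exists_dualAct_eq hO hξ₀ hξ
    have hm : Measurable fun g : H => φ (dualAct (g : GLd d) (dualAct (k : GLd d) ξ₀)) :=
      hφm.comp (continuous_orbitMap _).measurable
    rw [lintegral_const_mul _ hm, mul_comm]
    refine mul_le_mul_right (hKφ.trans (le_of_eq ?_)) _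
    simp only [← dualAct_mul, ← Subgroup.coe_mul]
    exact (lintegral_mul_left_eq_self (fun g : H => φ (dualAct (g : GLd d) ξ₀)) k).symm
  have hC : ∀ η, φ η * orbitIntegral μ F η ≤
      φ η * (ENNReal.ofReal C₂ * C₁ * orbitIntegral μ F ξ₀) := by
    intro η
    by_cases hη : η ∈ S
    · refine mul_le_mul_right ?_ _
      rw [hS] at hη
      obtain ⟨k, hk, rfl⟩ := hη
      refine (orbitIntegral_dualAct_le μ hF k (hright k hk) ξ₀).trans ?_
      rw [mul_assoc]
      exact mul_le_mul_left (ENNReal.ofReal_le_ofReal ((le_abs_self _).trans (hC₂ k hk))) _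
    · simp [hφ, hη]
  have hD : μ K * ∫⁻ ξ in O, F ξ ≤
      volume S * (ENNReal.ofReal C₂ * C₁) * orbitIntegral μ F ξ₀ := by
    calc μ K * ∫⁻ ξ in O, F ξ
        ≤ ∫⁻ ξ in O, ∫⁻ g : H, F ξ * φ (dualAct (g : GLd d) ξ) ∂μ := hA
      _ ≤ ∫⁻ ξ, ∫⁻ g : H, F ξ * φ (dualAct (g : GLd d) ξ) ∂μ := setLIntegral_le_lintegral _ _
      _ ≤ ∫⁻ η, φ η * (ENNReal.ofReal C₂ * C₁ * orbitIntegral μ F ξ₀) := by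
        rw [lintegral_lintegral_dualAct μ hF hφm]
        exact lintegral_mono hC
      _ = volume S * (ENNReal.ofReal C₂ * C₁) * orbitIntegral μ F ξ₀ := by
        rw [lintegral_mul_const _ hφm, hφ, lintegral_indicator_one hSm, mul_assoc, mul_assoc,
          mul_assoc]
  calc ∫⁻ ξ in O, F ξ = (μ K)⁻¹ * (μ K * ∫⁻ ξ in O, F ξ) := by
        rw [← mul_assoc, ENNReal.inv_mul_cancel hpos.ne' hfin, one_mul]
    _ ≤ (μ K)⁻¹ * (volume S * (ENNReal.ofReal C₂ * C₁) * orbitIntegral μ F ξ₀) :=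
        mul_le_mul_right hD _
    _ = (μ K)⁻¹ * (volume S * (ENNReal.ofReal C₂ * C₁)) * orbitIntegral μ F ξ₀ := by
        simp only [mul_assoc]

end Orbit

/-! ### Measurability of the wavelet transform -/

theorem quasiMeasurePreserving_act_sub (x : E d) (h : GLd d) :
    Measure.QuasiMeasurePreserving (fun y : E d => act h (y - x)) volume volume := by
  have h1 : Measure.QuasiMeasurePreserving (act h : E d → E d) volume volume := by
    refine ⟨(act h).continuous.measurable, ?_⟩
    rw [map_act_volume]
    exact Measure.smul_absolutelyContinuous
  exact h1.comp (measurePreserving_sub_right volume x).quasiMeasurePreserving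

/-- Invertible affine maps preserve null sets, so the transforms agree at every `(x,h)`. This
permits passing to measurable representatives. -/
theorem waveletTransform_congr (H : Subgroup (GLd d)) {f f' ψ ψ' : E d → ℂ}
    (hf : f =ᵐ[volume] f') (hψ : ψ =ᵐ[volume] ψ') :
    waveletTransform H ψ f = waveletTransform H ψ' f' := by
  funext x h
  refine integral_congr_ae ?_
  filter_upwards [hf, (quasiMeasurePreserving_act_sub x (h : GLd d)⁻¹).ae_eq_comp hψ] with y h1 h2
  simp only [Function.comp_apply] at h2
  simp only [quasiRegFun, h1, h2]

theorem waveletTransform_eq_zero (H : Subgroup (GLd d)) {f ψ : E d → ℂ}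
    (h : f =ᵐ[volume] 0 ∨ ψ =ᵐ[volume] 0) : waveletTransform H ψ f = 0 := by
  rcases h with h | h
  · rw [waveletTransform_congr H h (Filter.EventuallyEq.refl _ ψ)]
    funext x k
    simp [waveletTransform]
  · rw [waveletTransform_congr H (Filter.EventuallyEq.refl _ f) h]
    funext x k
    simp [waveletTransform, quasiRegFun]

theorem stronglyMeasurable_waveletTransform {H : Subgroup (GLd d)} [MeasurableSpace H]
    [BorelSpace H] [SecondCountableTopology H] {f ψ : E d → ℂ} (hf : Integrable f)
    (hψ : Integrable ψ) :
    StronglyMeasurable fun g : E d × H => waveletTransform H ψ f g.1 g.2 := by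
  rw [waveletTransform_congr H hf.1.ae_eq_mk hψ.1.ae_eq_mk]
  have hf' := hf.1.stronglyMeasurable_mk.measurable
  have hψ' := hψ.1.stronglyMeasurable_mk.measurable
  have hact : Measurable fun p : (E d × H) × E d => act (p.1.2 : GLd d)⁻¹ (p.2 - p.1.1) := by
    refine Continuous.measurable ?_
    exact (continuous_act.comp (continuous_inv.comp (continuous_subtype_val.comp
      (continuous_snd.comp continuous_fst)))).clm_apply
        (continuous_snd.sub (continuous_fst.comp continuous_fst))
  have hdet : Measurable fun p : (E d × H) × E d =>
      ((absDet (p.1.2 : GLd d) ^ (-(1 / 2) : ℝ) : ℝ) : ℂ) := by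
    refine Complex.measurable_ofReal.comp ?_
    exact ((continuous_absDet_coe (H := H)).measurable.comp
      (measurable_snd.comp measurable_fst)).pow_const _
  refine StronglyMeasurable.integral_prod_right (f := fun (g : E d × H) (y : E d) =>
    hf.1.mk f y * conj (quasiRegFun g.1 (g.2 : GLd d) (hψ.1.mk ψ) y)) ?_
  refine Measurable.stronglyMeasurable ?_
  exact (hf'.comp measurable_snd).mul
    (Complex.continuous_conj.measurable.comp (hdet.mul (hψ'.comp hact)))

/-! ### The overlap integral -/

/-- The weight that occurs in the definition of temperate embeddings. -/
def embeddingWeight {H : Subgroup (GLd d)} (s q : ℝ) (w : H → ℝ) (h : H) : ℝ :=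
  absDet (h : GLd d) ^ (1 / 2 - 1 / q) * (1 + opNorm (h : GLd d)) ^ (s + d + 1) * w h

theorem opNorm_nonneg (h : GLd d) : 0 ≤ opNorm h := norm_nonneg _

theorem one_add_opNorm_mul_le (h g : GLd d) :
    1 + opNorm (h * g) ≤ (1 + opNorm h) * (1 + opNorm g) := by
  have e : act (h * g) = act h * act g := by
    simp only [act, Units.val_mul, map_mul]
  have h1 : opNorm (h * g) ≤ opNorm h * opNorm g := by
    rw [opNorm, e]
    exact norm_mul_le _ _
  nlinarith [opNorm_nonneg h, opNorm_nonneg g]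

theorem embeddingWeight_pos {H : Subgroup (GLd d)} (s q : ℝ) {w : H → ℝ} (hw : IsWeight H w)
    (h : H) : 0 < embeddingWeight s q w h := by
  have h1 := absDet_pos (h : GLd d)
  have h2 := opNorm_nonneg (h : GLd d)
  have h3 := hw.pos h
  unfold embeddingWeight
  positivity

theorem embeddingWeight_mul_le {H : Subgroup (GLd d)} {s : ℝ} (hs : 0 ≤ s) (q : ℝ) {w : H → ℝ}
    (hw : IsWeight H w) (h g : H) :
    embeddingWeight s q w (h * g) ≤ embeddingWeight s q w h * embeddingWeight s q w g := by
  have h1 := absDet_pos (h : GLd d)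
  have h2 := absDet_pos (g : GLd d)
  have h3 := opNorm_nonneg (h : GLd d)
  have h4 := opNorm_nonneg (g : GLd d)
  have h5 := hw.pos h
  have h6 := hw.pos g
  have h7 := opNorm_nonneg ((h : GLd d) * (g : GLd d))
  have h8 := hw.pos (h * g)
  have e1 : absDet ((h * g : H) : GLd d) ^ (1 / 2 - 1 / q) =
      absDet (h : GLd d) ^ (1 / 2 - 1 / q) * absDet (g : GLd d) ^ (1 / 2 - 1 / q) := by
    rw [Subgroup.coe_mul, absDet_mul, Real.mul_rpow h1.le h2.le]
  have e2 : (1 + opNorm ((h * g : H) : GLd d)) ^ (s + d + 1) ≤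
      (1 + opNorm (h : GLd d)) ^ (s + d + 1) * (1 + opNorm (g : GLd d)) ^ (s + d + 1) := by
    rw [Subgroup.coe_mul, ← Real.mul_rpow (by positivity) (by positivity)]
    exact Real.rpow_le_rpow (by positivity) (one_add_opNorm_mul_le _ _) (by positivity)
  unfold embeddingWeight
  rw [e1]
  calc absDet (h : GLd d) ^ (1 / 2 - 1 / q) * absDet (g : GLd d) ^ (1 / 2 - 1 / q) *
        (1 + opNorm ((h * g : H) : GLd d)) ^ (s + d + 1) * w (h * g)
      ≤ absDet (h : GLd d) ^ (1 / 2 - 1 / q) * absDet (g : GLd d) ^ (1 / 2 - 1 / q) *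
        ((1 + opNorm (h : GLd d)) ^ (s + d + 1) * (1 + opNorm (g : GLd d)) ^ (s + d + 1)) *
        (w h * w g) := by
        gcongr
        exact hw.submul h g
    _ = _ := by ring

theorem continuous_embeddingWeight {H : Subgroup (GLd d)} (s q : ℝ) {w : H → ℝ}
    (hw : IsWeight H w) : Continuous (embeddingWeight s q w) := by
  have h1 : Continuous fun h : H => absDet (h : GLd d) ^ (1 / 2 - 1 / q) :=
    continuous_absDet_coe.rpow_const fun h => Or.inl (absDet_pos (h : GLd d)).ne'
  have h2 : Continuous fun h : H => 1 + opNorm (h : GLd d) :=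
    continuous_const.add (continuous_opNorm.comp continuous_subtype_val)
  have h3 : Continuous fun h : H => (1 + opNorm (h : GLd d)) ^ (s + d + 1) :=
    h2.rpow_const fun h => Or.inl (by have := opNorm_nonneg (h : GLd d); positivity)
  exact (h1.mul h3).mul hw.continuous

/-- The spare power of `auxA` is spent here: `auxA` vanishes off `O`, so exponent `ℓ + 1` confines
the integral to `O` even if `ℓ = 0`, without any claim on the measure of `Oᶜ`. -/
theorem lintegral_overlap_succ_le {O : Set (E d)} (hO : MeasurableSet O) (ℓ : ℕ) (h : GLd d) :
    ∫⁻ ξ, ENNReal.ofReal (overlap O (ℓ + 1) h ξ) ≤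
      ∫⁻ ξ in O, ENNReal.ofReal (overlap O ℓ h ξ) := by
  rw [← lintegral_indicator hO]
  refine lintegral_mono fun ξ => ?_
  by_cases hξ : ξ ∈ O
  · rw [Set.indicator_of_mem hξ]
    refine ENNReal.ofReal_le_ofReal ?_
    unfold overlap
    have h1 := auxA_nonneg O ξ
    have h2 := auxA_nonneg O (dualAct h ξ)
    gcongr ?_ * ?_
    · exact pow_le_pow_of_le_one h1 (auxA_le_one _ _) (Nat.le_succ _)
    · exact pow_le_pow_of_le_one h2 (auxA_le_one _ _) (Nat.le_succ _)
  · have h0 : auxA O ξ = 0 := by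
      have : Metric.infDist ξ Oᶜ = 0 := Metric.infDist_zero_of_mem hξ
      rw [auxA, this, zero_div]
      exact min_eq_left (by positivity)
    simp [overlap, h0]

section

variable {H : Subgroup (GLd d)} [MeasurableSpace H] [BorelSpace H]
  [SecondCountableTopology H] [LocallyCompactSpace H]

/-- For a temperately embedded orbit, the weighted overlap integral is dominated by a function
in `L^q(H)`. -/
theorem exists_dominating_overlap (μ : Measure H) [μ.IsHaarMeasure] {O : Set (E d)}
    (hO : IsOpenDualOrbit H O) {s q : ℝ} (hs : 0 ≤ s) (hq : 1 ≤ q) {w : H → ℝ}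
    (hw : IsWeight H w) {ℓ : ℕ} (hemb : IsTemperatelyEmbedded H μ O s q w ℓ) :
    ∃ G : H → ℝ≥0∞, Measurable G ∧ ∫⁻ h, G h ^ q ∂μ < ⊤ ∧
      ∀ h : H, ENNReal.ofReal (embeddingWeight s q w h) *
        ∫⁻ ξ in O, ENNReal.ofReal (overlap O ℓ (h : GLd d) ξ) ≤ G h := by
  obtain ⟨ξ₀, hξ₀, hc, hb⟩ := hemb
  obtain ⟨C, hC, horb⟩ := exists_lintegral_orbit_le μ hO hξ₀
  have hq0 : 0 < q := by linarith
  have hupos := embeddingWeight_pos (H := H) s q hw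
  have hum : Measurable (embeddingWeight s q w) := (continuous_embeddingWeight s q hw).measurable
  obtain ⟨a, ha⟩ : ∃ a : H → ℝ, a = fun g : H => auxA O (dualAct (g : GLd d) ξ₀) ^ ℓ := ⟨_, rfl⟩
  have ha0 : ∀ g, 0 ≤ a g := fun g => by rw [ha]; exact pow_nonneg (auxA_nonneg _ _) _
  have ham : Measurable a := by
    rw [ha]
    exact (((continuous_auxA O).comp (continuous_orbitMap ξ₀)).pow ℓ).measurable
  have hdm := measurable_ofReal_inv_absDet (H := H)
  -- The factor `|det k|⁻¹` from the orbit integral turns the exponent `1/2 - 1/q` into `-1/2 -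
  -- 1/q`, so `b` is the `L¹` function of the temperate embedding, and `c` below is the `L^q` one.
  obtain ⟨b, hbdef⟩ : ∃ b : H → ℝ≥0∞, b = fun k : H =>
      ENNReal.ofReal (embeddingWeight s q w k) * ENNReal.ofReal (a k⁻¹) *
        ENNReal.ofReal (absDet (k : GLd d))⁻¹ := ⟨_, rfl⟩
  obtain ⟨c, hcdef⟩ : ∃ c : H → ℝ≥0∞, c = fun g : H =>
      ENNReal.ofReal (embeddingWeight s q w g) * ENNReal.ofReal (a g) := ⟨_, rfl⟩
  have hbm : Measurable b := by
    rw [hbdef]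
    exact (hum.ennreal_ofReal.mul (ham.comp measurable_inv).ennreal_ofReal).mul hdm
  have hcm : Measurable c := by
    rw [hcdef]
    exact hum.ennreal_ofReal.mul ham.ennreal_ofReal
  have hbfin : ∫⁻ k, b k ∂μ < ⊤ := by
    have h1 := hb.2
    rw [eLpNorm_one_eq_lintegral_enorm] at h1
    refine lt_of_le_of_lt (le_of_eq (lintegral_congr fun k => ?_)) h1
    have hk0 := absDet_pos (k : GLd d)
    have e : absDet (k : GLd d) ^ (-(1 / 2) - 1 / q) =
        absDet (k : GLd d) ^ (1 / 2 - 1 / q) * (absDet (k : GLd d))⁻¹ := by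
      rw [← Real.rpow_neg_one (absDet (k : GLd d)), ← Real.rpow_add hk0]
      congr 1
      ring
    have hak : auxA O (dualAct (k : GLd d)⁻¹ ξ₀) ^ ℓ = a k⁻¹ := by simp only [ha, Subgroup.coe_inv]
    simp only [hbdef]
    rw [← ENNReal.ofReal_mul (hupos k).le,
      ← ENNReal.ofReal_mul (mul_nonneg (hupos k).le (ha0 _)), e, hak,
      Real.enorm_of_nonneg]
    · congr 1
      unfold embeddingWeight
      ring
    · have h1 := hw.pos k
      have h2 := opNorm_nonneg (k : GLd d)
      have h3 := ha0 k⁻¹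
      positivity
  have hcfin : ∫⁻ g, c g ^ q ∂μ < ⊤ := by
    have h1 := lintegral_rpow_enorm_lt_top_of_eLpNorm_lt_top (by simpa using hq0)
      ENNReal.ofReal_ne_top hc.2
    rw [ENNReal.toReal_ofReal hq0.le] at h1
    refine lt_of_le_of_lt (le_of_eq (lintegral_congr fun k => ?_)) h1
    have hak : auxA O (dualAct (k : GLd d) ξ₀) ^ ℓ = a k := by rw [ha]
    simp only [hcdef]
    rw [hak, ← ENNReal.ofReal_mul (hupos k).le, ← embeddingWeight, Real.enorm_of_nonneg]
    exact mul_nonneg (hupos k).le (ha0 _)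
  refine ⟨fun h => C * ∫⁻ k, b k * c (k⁻¹ * h) ∂μ, ?_, ?_, fun h => ?_⟩
  · refine Measurable.const_mul ?_ _
    refine Measurable.lintegral_prod_right' (f := fun p : H × H => b p.2 * c (p.2⁻¹ * p.1)) ?_
    fun_prop
  · have h1 := lintegral_convolution_rpow_le μ hbm hcm hq
    simp only [ENNReal.mul_rpow_of_nonneg _ _ hq0.le]
    rw [lintegral_const_mul' _ _ (ENNReal.rpow_ne_top_of_nonneg hq0.le hC)]
    refine ENNReal.mul_lt_top (ENNReal.rpow_lt_top_of_nonneg hq0.le hC) (h1.trans_lt ?_)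
    exact ENNReal.mul_lt_top (ENNReal.rpow_lt_top_of_nonneg hq0.le hbfin.ne) hcfin
  · have h1 := horb (fun ξ => ENNReal.ofReal (overlap O ℓ (h : GLd d) ξ))
      (continuous_overlap O ℓ (h : GLd d)).measurable.ennreal_ofReal
    refine (mul_le_mul_right h1 _).trans ?_
    rw [mul_left_comm]
    refine mul_le_mul_right ?_ _
    rw [orbitIntegral, ← lintegral_const_mul' _ _ ENNReal.ofReal_ne_top]
    refine lintegral_mono fun k => ?_
    have e1 : overlap O ℓ (h : GLd d) (dualAct (k : GLd d)⁻¹ ξ₀) = a k⁻¹ * a (k⁻¹ * h) := by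
      simp only [overlap, ← dualAct_mul, ha, Subgroup.coe_mul, Subgroup.coe_inv]
    have e2 : embeddingWeight s q w h ≤
        embeddingWeight s q w k * embeddingWeight s q w (k⁻¹ * h) := by
      have := embeddingWeight_mul_le hs q hw k (k⁻¹ * h)
      rwa [mul_inv_cancel_left] at this
    simp only [e1]
    rw [ENNReal.ofReal_mul (ha0 _)]
    calc ENNReal.ofReal (embeddingWeight s q w h) *
          (ENNReal.ofReal (a k⁻¹) * ENNReal.ofReal (a (k⁻¹ * h)) *
            ENNReal.ofReal (absDet (k : GLd d))⁻¹)
        ≤ ENNReal.ofReal (embeddingWeight s q w k * embeddingWeight s q w (k⁻¹ * h)) *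
          (ENNReal.ofReal (a k⁻¹) * ENNReal.ofReal (a (k⁻¹ * h)) *
            ENNReal.ofReal (absDet (k : GLd d))⁻¹) :=
          mul_le_mul_left (ENNReal.ofReal_le_ofReal e2) _
      _ = b k * c (k⁻¹ * h) := by
          rw [ENNReal.ofReal_mul (hupos k).le, hbdef, hcdef]
          ring

end

/-! ### Mixed norms of wavelet coefficients -/

theorem eLpNorm_one_add_norm_rpow_lt_top {p : ℝ≥0∞} (hp : 1 ≤ p) {r : ℝ}
    (hr : d * (p⁻¹).toReal < r) :
    eLpNorm (fun x : E d => (1 + ‖x‖) ^ (-r)) p volume < ⊤ := by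
  have hr0 : 0 < r := lt_of_le_of_lt (by positivity) hr
  have hnn : ∀ x : E d, 0 ≤ (1 + ‖x‖) ^ (-r) := fun x => by positivity
  rcases eq_or_ne p ⊤ with rfl | hpt
  · rw [eLpNorm_exponent_top]
    refine (eLpNormEssSup_lt_top_of_ae_bound (C := 1) (Filter.Eventually.of_forall fun x => ?_))
    rw [Real.norm_of_nonneg (hnn x)]
    exact Real.rpow_le_one_of_one_le_of_nonpos (by linarith [norm_nonneg x]) (by linarith)
  · have hp0 : p ≠ 0 := (zero_lt_one.trans_le hp).ne'
    have hpr : 0 < p.toReal := ENNReal.toReal_pos hp0 hpt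
    rw [eLpNorm_lt_top_iff_lintegral_rpow_enorm_lt_top hp0 hpt]
    have hrp : (Module.finrank ℝ (E d) : ℝ) < r * p.toReal := by
      rw [finrank_euclideanSpace_fin]
      rw [ENNReal.toReal_inv, ← div_eq_mul_inv, div_lt_iff₀ hpr] at hr
      exact hr
    refine lt_of_le_of_lt (le_of_eq (lintegral_congr fun x => ?_))
      (finite_integral_one_add_norm (μ := (volume : Measure (E d))) hrp)
    rw [Real.enorm_of_nonneg (hnn x), ENNReal.ofReal_rpow_of_nonneg (hnn x) hpr.le,
      ← Real.rpow_mul (by positivity), neg_mul]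

theorem le_schwartzNorm_toReal {t : ℕ} {F : E d → ℂ} (hF : schwartzNorm t t F ≠ ⊤) (x : E d)
    (α : Fin d → ℕ) (hα : ∑ i, α i ≤ t) :
    (1 + ‖x‖) ^ t * ‖multiDeriv α F x‖ ≤ (schwartzNorm t t F).toReal := by
  rw [← ENNReal.ofReal_le_iff_le_toReal hF]
  unfold schwartzNorm
  exact le_iSup_of_le x (le_iSup_of_le α (le_iSup_of_le hα le_rfl))

/-- Serves the convention `0 · ∞ = 0`: if one norm vanishes, the wavelet transform has to vanish
even when the other norm is infinite. -/
theorem ae_eq_zero_of_schwartzNorm_eq_zero {t : ℕ} {f : E d → ℂ} (hf : Integrable f)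
    (h : schwartzNorm t t (𝓕 f) = 0) : f =ᵐ[volume] 0 := by
  have h0 : 𝓕 f = fun _ => 0 := by
    funext x
    have := le_schwartzNorm_toReal (t := t) (F := 𝓕 f) (by simp [h]) x 0 (by simp)
    rw [h, ENNReal.toReal_zero, multiDeriv_zero] at this
    have hpos : 0 < (1 + ‖x‖) ^ t := by positivity
    exact norm_le_zero_iff.1 (nonpos_of_mul_nonpos_right this hpos)
  have h1 := ae_eq_fourierInv_fourier hf (by rw [h0]; exact integrable_zero _ _ _)
  refine h1.trans (Filter.Eventually.of_forall fun x => ?_)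
  rw [h0, Real.fourierInv_eq_fourier_neg, Real.fourier_eq]
  simp

/-- The mixed-norm integrand at `h`, bounded by the weighted overlap integral. -/
theorem eLpNorm_waveletTransform_rpow_le (hd : 1 ≤ d) {H : Subgroup (GLd d)} {O : Set (E d)}
    (hO : IsOpenDualOrbit H O) {p : ℝ≥0∞} {q : ℝ} (hq : 1 ≤ q) {s : ℝ}
    {v : E d → H → ℝ} (hv : IsWeightG H v) {w : H → ℝ} (hw : IsWeight H w)
    (hvw : ∀ x h, v x h ≤ (1 + ‖x‖) ^ s * w h) {t ℓ m : ℕ} (hmt : m + (ℓ + 1) ≤ t)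
    (hms : (m : ℝ) ≤ s + d + 1) {f ψ : E d → ℂ} (hf : HasVanishingMoments O t f)
    (hψ : HasVanishingMoments O t ψ) (hfN : schwartzNorm t t (𝓕 f) ≠ ⊤)
    (hψN : schwartzNorm t t (𝓕 ψ) ≠ ⊤) (h : H) {B : ℝ≥0∞} (hB : B ≠ ⊤)
    (hBh : ENNReal.ofReal (embeddingWeight s q w h) *
      ∫⁻ ξ in O, ENNReal.ofReal (overlap O ℓ (h : GLd d) ξ) ≤ B) :
    eLpNorm (fun x => waveletTransform H ψ f x h * (v x h : ℂ)) p volume ^ q *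
        ENNReal.ofReal (absDet (h : GLd d))⁻¹ ≤
      (ENNReal.ofReal (decayConst d t m) *
        (schwartzNorm t t (𝓕 f) * schwartzNorm t t (𝓕 ψ)) *
        eLpNorm (fun x : E d => (1 + ‖x‖) ^ (-(m - s : ℝ))) p volume * B) ^ q := by
  have hq0 : 0 < q := by linarith
  have hdet := absDet_pos (h : GLd d)
  have hop := opNorm_nonneg (h : GLd d)
  have hwh := hw.pos h
  have hu := embeddingWeight_pos s q hw h
  have hov0 := overlap_nonneg O (ℓ + 1) (h : GLd d)
  set N := (schwartzNorm t t (𝓕 f)).toReal with hN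
  set M := (schwartzNorm t t (𝓕 ψ)).toReal with hM
  have hN0 : 0 ≤ N := ENNReal.toReal_nonneg
  have hM0 : 0 ≤ M := ENNReal.toReal_nonneg
  have hdc : 0 ≤ decayConst d t m := by unfold decayConst; positivity
  -- The embedding weight is strictly positive, so the finite bound `B` forces the overlap integral
  -- itself to be finite.
  have hΦfin : ∫⁻ ξ in O, ENNReal.ofReal (overlap O ℓ (h : GLd d) ξ) ≠ ⊤ := by
    intro htop
    rw [htop, ENNReal.mul_top (by simpa using hu)] at hBh
    exact hB (top_le_iff.1 hBh)
  have hΦ1 := lintegral_overlap_succ_le hO.1.measurableSet ℓ (h : GLd d)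
  have hint : Integrable (overlap O (ℓ + 1) (h : GLd d)) := by
    refine ⟨(continuous_overlap O (ℓ + 1) (h : GLd d)).aestronglyMeasurable, ?_⟩
    rw [hasFiniteIntegral_iff_ofReal (Filter.Eventually.of_forall hov0)]
    exact hΦ1.trans_lt hΦfin.lt_top
  set I := ∫ ξ, overlap O (ℓ + 1) (h : GLd d) ξ with hI
  have hI0 : 0 ≤ I := integral_nonneg hov0
  have hIle : ENNReal.ofReal I ≤ ∫⁻ ξ in O, ENNReal.ofReal (overlap O ℓ (h : GLd d) ξ) := by
    rw [hI, ofReal_integral_eq_lintegral_ofReal hint (Filter.Eventually.of_forall hov0)]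
    exact hΦ1
  set κ := decayConst d t m * (N * M) * (absDet (h : GLd d) ^ (1 / 2 : ℝ) *
    (1 + opNorm (h : GLd d)) ^ m * I) with hκ
  have hκ0 : 0 ≤ κ := by positivity
  have hae : ∀ᵐ x : E d, ‖waveletTransform H ψ f x h * (v x h : ℂ)‖ ≤
      (κ * w h) * (1 + ‖x‖) ^ (-(m - s : ℝ)) := by
    filter_upwards [norm_waveletTransform_le hd hO hmt hf.1 hψ.1 hf.flatOn hψ.flatOn
      (le_schwartzNorm_toReal hfN) (le_schwartzNorm_toReal hψN) h hint] with x hx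
    have hx1 : 0 < 1 + ‖x‖ := by positivity
    have hvx := hv.pos x h
    have e : (1 + ‖x‖) ^ (-(m - s : ℝ)) = (1 + ‖x‖) ^ s / (1 + ‖x‖) ^ m := by
      rw [neg_sub, Real.rpow_sub hx1, Real.rpow_natCast]
    rw [norm_mul, Complex.norm_real, Real.norm_of_nonneg hvx.le, e]
    have h1 : ‖waveletTransform H ψ f x h‖ ≤ κ / (1 + ‖x‖) ^ m := by
      rw [le_div_iff₀ (by positivity), mul_comm]
      exact hx
    calc ‖waveletTransform H ψ f x h‖ * v x h
        ≤ κ / (1 + ‖x‖) ^ m * ((1 + ‖x‖) ^ s * w h) :=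
          mul_le_mul h1 (hvw x h) hvx.le (by positivity)
      _ = κ * w h * ((1 + ‖x‖) ^ s / (1 + ‖x‖) ^ m) := by ring
  have hL : eLpNorm (fun x => waveletTransform H ψ f x h * (v x h : ℂ)) p volume ≤
      ENNReal.ofReal (κ * w h) *
        eLpNorm (fun x : E d => (1 + ‖x‖) ^ (-(m - s : ℝ))) p volume := by
    refine (eLpNorm_mono_ae_real hae).trans (le_of_eq ?_)
    have := eLpNorm_const_smul (κ * w h) (fun x : E d => (1 + ‖x‖) ^ (-(m - s : ℝ))) p volume
    rw [Real.enorm_of_nonneg (by positivity)] at this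
    exact this
  -- Pulled inside the `q`-th power, the Haar density becomes `|det h|^{-1/q}`; together with the
  -- `|det h|^{1/2}` in `κ` it gives the exponent of `embeddingWeight`.
  have hroot : ENNReal.ofReal (absDet (h : GLd d))⁻¹ =
      ENNReal.ofReal (absDet (h : GLd d) ^ (-(1 / q))) ^ q := by
    rw [ENNReal.ofReal_rpow_of_pos (by positivity), ← Real.rpow_mul hdet.le, neg_mul,
      one_div_mul_cancel hq0.ne', Real.rpow_neg_one]
  have hprod : ENNReal.ofReal (κ * w h) * ENNReal.ofReal (absDet (h : GLd d) ^ (-(1 / q))) ≤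
      ENNReal.ofReal (decayConst d t m) *
        (schwartzNorm t t (𝓕 f) * schwartzNorm t t (𝓕 ψ)) * B := by
    have e1 : absDet (h : GLd d) ^ (1 / 2 - 1 / q) =
        absDet (h : GLd d) ^ (1 / 2 : ℝ) * absDet (h : GLd d) ^ (-(1 / q)) := by
      rw [← Real.rpow_add hdet, sub_eq_add_neg]
    have e2 : (1 + opNorm (h : GLd d)) ^ m ≤ (1 + opNorm (h : GLd d)) ^ (s + d + 1) := by
      rw [← Real.rpow_natCast]
      exact Real.rpow_le_rpow_of_exponent_le (by linarith) hms
    have e3 : κ * w h * absDet (h : GLd d) ^ (-(1 / q)) ≤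
        decayConst d t m * (N * M) * (embeddingWeight s q w h * I) := by
      have : κ * w h * absDet (h : GLd d) ^ (-(1 / q)) = decayConst d t m * (N * M) *
          (absDet (h : GLd d) ^ (1 / 2 - 1 / q) * (1 + opNorm (h : GLd d)) ^ m * w h * I) := by
        rw [hκ, e1]
        ring
      rw [this]
      unfold embeddingWeight
      gcongr
    rw [← ENNReal.ofReal_mul (by positivity)]
    refine (ENNReal.ofReal_le_ofReal e3).trans ?_
    rw [ENNReal.ofReal_mul (by positivity), ENNReal.ofReal_mul hdc, ENNReal.ofReal_mul hN0,
      ENNReal.ofReal_mul hu.le, hN, hM, ENNReal.ofReal_toReal hfN, ENNReal.ofReal_toReal hψN]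
    refine mul_le_mul_right ?_ _
    exact (mul_le_mul_right hIle _).trans hBh
  rw [hroot, ← ENNReal.mul_rpow_of_nonneg _ _ hq0.le]
  refine ENNReal.rpow_le_rpow ?_ hq0.le
  refine (mul_le_mul_left hL _).trans ?_
  rw [mul_right_comm, mul_right_comm _ (eLpNorm _ _ _)]
  exact mul_le_mul_left hprod _

end DualOrbit

end

/-! ### The mixed-norm estimate. -/

theorem theorem3p6 {d : ℕ} (hd : 1 ≤ d) (H : Subgroup (GLd d))
    [MeasurableSpace H] [BorelSpace H] (μ : Measure H) [μ.IsHaarMeasure]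
    (hH : IsAdmissibleGroup H μ) (O : Set (E d)) (hO : IsOpenDualOrbit H O)
    (p : ℝ≥0∞) (hp : 1 ≤ p) (q : ℝ) (hq : 1 ≤ q) (s : ℝ) (hs : 0 ≤ s)
    (v : E d → H → ℝ) (hv : IsWeightG H v) (w : H → ℝ) (hw : IsWeight H w)
    (hvw : ∀ x h, v x h ≤ (1 + ‖x‖) ^ s * w h)
    (ℓ : ℕ) (hemb : IsTemperatelyEmbedded H μ O s q w ℓ)
    (t : ℕ) (ht : (ℓ : ℝ) + s + 1 + d * (p⁻¹).toReal < t) :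
    ∃ C : ℝ≥0, 0 < C ∧ ∀ f ψ : E d → ℂ,
      HasVanishingMoments O t f → HasVanishingMoments O t ψ →
      AEStronglyMeasurable (fun g : E d × H => waveletTransform H ψ f g.1 g.2) (haarG H μ) ∧
      mixedNorm H μ p q v (waveletTransform H ψ f) ≤
        C * schwartzNorm t t (𝓕 f) * schwartzNorm t t (𝓕 ψ) := by
  have hsc : SecondCountableTopology (GLd d) := secondCountableTopology_GLd
  have hlc : LocallyCompactSpace (GLd d) := locallyCompactSpace_GLd
  have hscH : SecondCountableTopology H :=
    Topology.IsEmbedding.subtypeVal.secondCountableTopology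
  have hlcH : LocallyCompactSpace H := hH.closed.isClosedEmbedding_subtypeVal.locallyCompactSpace
  have hq0 : 0 < q := by linarith
  obtain ⟨G, hGm, hGfin, hG⟩ := exists_dominating_overlap μ hO hs hq hw hemb
  -- The least integer above `s + d/p`: large enough for `(1+|x|)^{s-m}` to be in `L^p`, yet at most
  -- `s + d + 1`, the exponent in the embedding weight. It satisfies `m + ℓ < t`, which over the
  -- integers yields the spare power in `m + (ℓ + 1) ≤ t`.
  obtain ⟨m, hm⟩ : ∃ m : ℕ, m = ⌊s + d * (p⁻¹).toReal⌋₊ + 1 := ⟨_, rfl⟩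
  have hdp : 0 ≤ (d : ℝ) * (p⁻¹).toReal := by positivity
  have hp1 : (p⁻¹).toReal ≤ 1 := by
    refine ENNReal.toReal_le_of_le_ofReal zero_le_one ?_
    simpa using hp
  have hm1 : s + d * (p⁻¹).toReal < m := by
    rw [hm]
    exact_mod_cast Nat.lt_floor_add_one _
  have hm2 : (m : ℝ) ≤ s + d * (p⁻¹).toReal + 1 := by
    rw [hm]
    push_cast
    linarith [Nat.floor_le (add_nonneg hs hdp)]
  have hmt : m + (ℓ + 1) ≤ t := by
    have : ((m + ℓ : ℕ) : ℝ) < t := by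
      push_cast
      linarith
    have : m + ℓ < t := by exact_mod_cast this
    omega
  have hms : (m : ℝ) ≤ s + d + 1 := by
    have : (d : ℝ) * (p⁻¹).toReal ≤ d := mul_le_of_le_one_right (Nat.cast_nonneg d) hp1
    linarith
  have hL := eLpNorm_one_add_norm_rpow_lt_top (d := d) hp (r := m - s) (by linarith)
  obtain ⟨L, hLdef⟩ : ∃ L : ℝ≥0∞,
      L = eLpNorm (fun x : E d => (1 + ‖x‖) ^ (-(m - s : ℝ))) p volume := ⟨_, rfl⟩
  rw [← hLdef] at hL
  obtain ⟨A, hA⟩ : ∃ A : ℝ≥0∞,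
      A = ENNReal.ofReal (decayConst d t m) * L * (∫⁻ h, G h ^ q ∂μ) ^ (1 / q) := ⟨_, rfl⟩
  have hAfin : A ≠ ⊤ := by
    rw [hA]
    refine ENNReal.mul_ne_top (ENNReal.mul_ne_top ENNReal.ofReal_ne_top hL.ne) ?_
    exact ENNReal.rpow_ne_top_of_nonneg (by positivity) hGfin.ne
  -- Adding one only ensures a positive constant, which also makes the right-hand side infinite when
  -- one norm is infinite and the other nonzero.
  refine ⟨A.toNNReal + 1, by positivity, fun f ψ hf hψ => ⟨?_, ?_⟩⟩
  · exact (stronglyMeasurable_waveletTransform hf.1 hψ.1).aestronglyMeasurable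
  by_cases h0 : schwartzNorm t t (𝓕 f) = 0 ∨ schwartzNorm t t (𝓕 ψ) = 0
  · have hW : waveletTransform H ψ f = 0 := waveletTransform_eq_zero H
      (h0.imp (ae_eq_zero_of_schwartzNorm_eq_zero hf.1) (ae_eq_zero_of_schwartzNorm_eq_zero hψ.1))
    rw [hW]
    simp [mixedNorm, hq0]
  push Not at h0
  have hC0 : ((A.toNNReal + 1 : ℝ≥0) : ℝ≥0∞) ≠ 0 := by positivity
  by_cases hfN : schwartzNorm t t (𝓕 f) = ⊤
  · rw [hfN, ENNReal.mul_top hC0, ENNReal.top_mul h0.2]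
    exact le_top
  by_cases hψN : schwartzNorm t t (𝓕 ψ) = ⊤
  · rw [hψN, ENNReal.mul_top (mul_ne_zero hC0 h0.1)]
    exact le_top
  -- The estimate for fixed `h` needs a finite bound; integrability of `G^q` supplies one for almost
  -- every `h`.
  have hGae : ∀ᵐ h ∂μ, G h < ⊤ := by
    filter_upwards [ae_lt_top (hGm.pow_const q) hGfin.ne] with h hh
    by_contra hcon
    rw [not_lt, top_le_iff] at hcon
    rw [hcon, ENNReal.top_rpow_of_pos hq0] at hh
    exact lt_irrefl _ hh
  obtain ⟨D, hD⟩ : ∃ D : ℝ≥0∞, D = ENNReal.ofReal (decayConst d t m) *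
      (schwartzNorm t t (𝓕 f) * schwartzNorm t t (𝓕 ψ)) * L := ⟨_, rfl⟩
  have hbound : ∀ᵐ h ∂μ,
      eLpNorm (fun x => waveletTransform H ψ f x h * (v x h : ℂ)) p volume ^ q *
        ENNReal.ofReal (absDet (h : GLd d))⁻¹ ≤ D ^ q * G h ^ q := by
    filter_upwards [hGae] with h hh
    rw [← ENNReal.mul_rpow_of_nonneg _ _ hq0.le, hD, hLdef]
    exact eLpNorm_waveletTransform_rpow_le hd hO hq hv hw hvw hmt hms hf hψ hfN hψN h hh.ne (hG h)
  calc mixedNorm H μ p q v (waveletTransform H ψ f)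
      ≤ (∫⁻ h, D ^ q * G h ^ q ∂μ) ^ (1 / q) :=
        ENNReal.rpow_le_rpow (lintegral_mono_ae hbound) (by positivity)
    _ = D * (∫⁻ h, G h ^ q ∂μ) ^ (1 / q) := by
        rw [lintegral_const_mul _ (hGm.pow_const q),
          ENNReal.mul_rpow_of_nonneg _ _ (by positivity), ← ENNReal.rpow_mul,
          mul_one_div_cancel hq0.ne', ENNReal.rpow_one]
    _ = A * (schwartzNorm t t (𝓕 f) * schwartzNorm t t (𝓕 ψ)) := by
        rw [hD, hA]
        ring
    _ ≤ ((A.toNNReal + 1 : ℝ≥0) : ℝ≥0∞) *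
          (schwartzNorm t t (𝓕 f) * schwartzNorm t t (𝓕 ψ)) := by
        refine mul_le_mul_left ?_ _
        rw [ENNReal.coe_add, ENNReal.coe_toNNReal hAfin]
        exact le_self_add
    _ = _ := by rw [mul_assoc]
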